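/- **Change of scattering data under a one-fold Darboux transformation.** Notation: $\mathbb{C}_\pm=\{\pm\operatorname{Im}\lambda>0\}$, $*$ is complex conjugation, $\sigma_3=\operatorname{diag}(1,-1)$, $\theta(t,x,\lambda)=\lambda x+2\lambda^2t$, $Q=\begin{pmatrix}0&u\\-u^*&0\end{pmatrix}$, and $H^{1,1}(\mathbb{R})=\{f\in L^2(\mathbb{R}):xf,\,f_x\in L^2(\mathbb{R})\}$ (continuous representatives). For $u(t,\cdot)\in H^{1,1}(\mathbb{R})$ the Jost solutions are $\psi_\pm=m_\pm e^{-i\theta\sigma_3}$, where the columns of $m_\pm$ are the bounded solutions of the columns of $$m_-(t,x,\lambda)=1+\int_{-\infty}^x e^{-i\lambda(x-y)\sigma_3}Q(t,y)\,m_-(t,y,\lambda)\,e^{i\lambda(x-y)\sigma_3}\,dy,$$ $$m_+(t,x,\lambda)=1-\int_x^{\infty} e^{-i\lambda(x-y)\sigma_3}Q(t,y)\,m_+(t,y,\lambda)\,e^{i\lambda(x-y)\sigma_3}\,dy.$$ All columns are considered for $\lambda\in\mathbb{R}$; $\psi_-^{(1)}$ and $\psi_+^{(2)}$ are considered for all $\lambda\in\mathbb{C}_+\cup\mathbb{R}$.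 Put $A(\lambda)=\psi_+^{-1}\psi_-$ for $\lambda\in\mathbb{R}$ (independent of $x$), with entries $a_{11},a_{12},\dots$, and $a_{11}(\lambda)=\det[\psi_-^{(1)}\,|\,\psi_+^{(2)}]$ for $\lambda\in\mathbb{C}_+$. Call $u(t,\cdot)$ *generic* if $a_{11}$ is nonzero on $\mathbb{C}_+\cup\mathbb{R}$ except at finitely many distinct points $\lambda_1,\dots,\lambda_N\in\mathbb{C}_+$ ($N\ge 0$, the *eigenvalues*), at which $\frac{d a_{11}}{d\lambda}(\lambda_j)\neq0$. Its scattering data are then $a_{11}$ on $\mathbb{C}_+\cup\mathbb{R}$, $a_{12}$ and $\rho=a_{12}/a_{11}$ on $\mathbb{R}$, the eigenvalues $\lambda_j$, the constants $b_j$ defined by $\psi_-^{(1)}(t,x,\lambda_j)=b_j\,\psi_+^{(2)}(t,x,\lambda_j)$ for all $x$, and the weights $C_j=b_j\bigl(\frac{d a_{11}}{d\lambda}(\lambda_j)\bigr)^{-1}$. **Theorem.** Fix $t\in\mathbb{R}$, let $u(t,\cdot)\in H^{1,1}(\mathbb{R})$ be generic with scattering data as above, let $\lambda_0\in\mathbb{C}_+\setminus\{\lambda_1,\dots,\lambda_N\}$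 and $u_0,v_0\in\mathbb{C}\setminus\{0\}$, and put $$\psi_0=u_0\,\psi_-^{(1)}(t,x,\lambda_0)+v_0\,\psi_+^{(2)}(t,x,\lambda_0),\qquad P=\frac{\psi_0\psi_0^\dagger}{\psi_0^\dagger\psi_0}.$$ Let $u'$ be the potential produced by the one-fold Darboux transformation $D=(\lambda-\lambda_0^*)1+(\lambda_0^*-\lambda_0)P$, that is, $u'$ is the upper right entry of $Q-i(\lambda_0-\lambda_0^*)[\sigma_3,P]$. Then $u'(t,\cdot)\in H^{1,1}(\mathbb{R})$ is generic, its eigenvalues are exactly $\lambda_0,\lambda_1,\dots,\lambda_N$, and its scattering data are $$a_{11}'(\lambda)=\frac{\lambda-\lambda_0}{\lambda-\lambda_0^*}\,a_{11}(\lambda)\ \ (\lambda\in\mathbb{C}_+\cup\mathbb{R}),\qquad a_{12}'(\lambda)=a_{12}(\lambda),\quad \rho'(\lambda)=\frac{\lambda-\lambda_0^*}{\lambda-\lambda_0}\,\rho(\lambda)\ \ (\lambda\in\mathbb{R}),$$ $$b_j'=b_j,\qquad C_j'=\frac{\lambda_j-\lambda_0^*}{\lambda_j-\lambda_0}\,C_j\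 \ (j=1,\dots,N),\qquad b_0'=-\frac{v_0}{u_0},\qquad C_0'=-\frac{v_0}{u_0}\,\frac{\lambda_0-\lambda_0^*}{a_{11}(\lambda_0)}.$$ Here a prime denotes the quantities belonging to $u'$. -/

import Mathlib

open Complex MeasureTheory
open scoped ComplexConjugate Matrix

noncomputable section

namespace NLSScattering

/-- `H^{1,1}(ℝ) = {f ∈ L² : x f ∈ L², f_x ∈ L²}`. As usual for `H¹` functions of one variable, `f` is
the continuous representative: it is an antiderivative of its weak derivative `g ∈ L²`. -/
def MemH11 (f : ℝ → ℂ) : Prop :=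
  MemLp f 2 volume ∧ MemLp (fun x : ℝ => (x : ℂ) * f x) 2 volume ∧
    ∃ g : ℝ → ℂ, MemLp g 2 volume ∧ ∀ x : ℝ, f x = f 0 + ∫ y in (0 : ℝ)..x, g y

/-- The diagonal entries `1, -1` of `σ₃`. -/
def sgn : Fin 2 → ℂ := ![1, -1]

/-- The matrix `σ₃ = diag(1, -1)`. -/
def sigma3 : Matrix (Fin 2) (Fin 2) ℂ := Matrix.diagonal sgn

/-- The matrix `Q` of the `x` part `U = -i λ σ₃ + Q` of the Lax pair, for the value `z` of the
potential. -/
def potentialMatrix (z : ℂ) : Matrix (Fin 2) (Fin 2) ℂ := !![0, z; -conj z, 0]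

/-- The phase `θ(t, x, λ) = λ x + 2 λ² t`. -/
def theta (t x : ℝ) (l : ℂ) : ℂ := l * x + 2 * l ^ 2 * t

/-- `m` is the `j`-th column of the modified Jost solution normalised at `x → -∞`, for the potential
`w = u(t, ·)` and the spectral parameter `l`: it is the bounded solution of the `j`-th column of
`m(x) = 1 + ∫_{-∞}^x e^{-iθ(0,x-y,l)σ₃} Q(y) m(y) e^{iθ(0,x-y,l)σ₃} dy`.
The first column (`j = 0`) is used for `Im l ≥ 0`, the second one for real `l`. -/
structure IsModifiedJostMinus (w : ℝ → ℂ) (l : ℂ) (j : Fin 2) (m : ℝ → Fin 2 → ℂ) : Prop where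
  continuous : Continuous m
  bounded : ∃ K : ℝ, ∀ x, ‖m x‖ ≤ K
  volterra : ∀ (x : ℝ) (i : Fin 2),
    m x i = (if i = j then 1 else 0) +
      ∫ y in Set.Iic x, exp (-(I * theta 0 (x - y) l * sgn i)) *
        (potentialMatrix (w y) *ᵥ m y) i * exp (I * theta 0 (x - y) l * sgn j)

/-- `m` is the `j`-th column of the modified Jost solution normalised at `x → +∞`: it is the bounded
solution of the `j`-th column of
`m(x) = 1 - ∫_x^∞ e^{-iθ(0,x-y,l)σ₃} Q(y) m(y) e^{iθ(0,x-y,l)σ₃} dy`.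
The second column (`j = 1`) is used for `Im l ≥ 0`, the first one for real `l`. -/
structure IsModifiedJostPlus (w : ℝ → ℂ) (l : ℂ) (j : Fin 2) (m : ℝ → Fin 2 → ℂ) : Prop where
  continuous : Continuous m
  bounded : ∃ K : ℝ, ∀ x, ‖m x‖ ≤ K
  volterra : ∀ (x : ℝ) (i : Fin 2),
    m x i = (if i = j then 1 else 0) -
      ∫ y in Set.Ioi x, exp (-(I * theta 0 (x - y) l * sgn i)) *
        (potentialMatrix (w y) *ᵥ m y) i * exp (I * theta 0 (x - y) l * sgn j)

/-- The `j`-th column of the modified Jost solution `m_-(t, ·, l)`, for `w = u(t, ·)`. -/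
def modifiedJostMinus (w : ℝ → ℂ) (l : ℂ) (j : Fin 2) : ℝ → Fin 2 → ℂ :=
  Classical.epsilon (IsModifiedJostMinus w l j)

/-- The `j`-th column of the modified Jost solution `m_+(t, ·, l)`, for `w = u(t, ·)`. -/
def modifiedJostPlus (w : ℝ → ℂ) (l : ℂ) (j : Fin 2) : ℝ → Fin 2 → ℂ :=
  Classical.epsilon (IsModifiedJostPlus w l j)

/-- The `j`-th column `ψ_-^{(j)}(t, x, l)` of the Jost solution `ψ_- = m_- e^{-iθσ₃}` of the
potential `u(t, x)`. -/
def jostMinus (u : ℝ → ℝ → ℂ) (t x : ℝ) (l : ℂ) (j : Fin 2) : Fin 2 → ℂ :=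
  exp (-(I * theta t x l * sgn j)) • modifiedJostMinus (u t) l j x

/-- The `j`-th column `ψ_+^{(j)}(t, x, l)` of the Jost solution `ψ_+ = m_+ e^{-iθσ₃}` of the
potential `u(t, x)`. -/
def jostPlus (u : ℝ → ℝ → ℂ) (t x : ℝ) (l : ℂ) (j : Fin 2) : Fin 2 → ℂ :=
  exp (-(I * theta t x l * sgn j)) • modifiedJostPlus (u t) l j x

/-- The `2 × 2` matrix `[a | b]` with columns `a` and `b`. -/
def columns (a b : Fin 2 → ℂ) : Matrix (Fin 2) (Fin 2) ℂ := !![a 0, b 0; a 1, b 1]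

/-- The scattering matrix `(ψ_+(t, x, ξ))⁻¹ ψ_-(t, x, ξ)` for real `ξ`. -/
def scatteringMatrix (u : ℝ → ℝ → ℂ) (t x ξ : ℝ) : Matrix (Fin 2) (Fin 2) ℂ :=
  (columns (jostPlus u t x ξ 0) (jostPlus u t x ξ 1))⁻¹ *
    columns (jostMinus u t x ξ 0) (jostMinus u t x ξ 1)

/-- At time `t` the potential `u(t, ·)` is generic in `H^{1,1}(ℝ)` and has the scattering data
`a₁₁` (on the closed upper half-plane), `a₁₂` and `ρ` (on the real line), eigenvalues `lam j`, and
for each eigenvalue the constant `b j` and the weight `C j`. -/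
structure IsScatteringData (u : ℝ → ℝ → ℂ) (t : ℝ) (a₁₁ : ℂ → ℂ) (a₁₂ ρ : ℝ → ℂ) {N : ℕ}
    (lam b C : Fin N → ℂ) : Prop where
  memH11 : MemH11 (u t)
  a₁₁_real : ∀ ξ x : ℝ, a₁₁ ξ = scatteringMatrix u t x ξ 0 0
  a₁₁_upper : ∀ l : ℂ, 0 < l.im → ∀ x : ℝ,
    a₁₁ l = (columns (jostMinus u t x l 0) (jostPlus u t x l 1)).det
  a₁₂_real : ∀ ξ x : ℝ, a₁₂ ξ = scatteringMatrix u t x ξ 0 1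
  ρ_eq : ∀ ξ : ℝ, ρ ξ = a₁₂ ξ / a₁₁ ξ
  lam_upper : ∀ j, 0 < (lam j).im
  lam_injective : Function.Injective lam
  zeros : ∀ l : ℂ, 0 ≤ l.im → (a₁₁ l = 0 ↔ ∃ j, l = lam j)
  simple : ∀ j, deriv a₁₁ (lam j) ≠ 0
  b_eq : ∀ j, ∀ x : ℝ, jostMinus u t x (lam j) 0 = b j • jostPlus u t x (lam j) 1
  C_eq : ∀ j, C j = b j * (deriv a₁₁ (lam j))⁻¹

/-- The projector `P[1] = ψ₀ ψ₀† / (ψ₀† ψ₀)`. -/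
def projector (ψ : Fin 2 → ℂ) : Matrix (Fin 2) (Fin 2) ℂ :=
  (star ψ ⬝ᵥ ψ)⁻¹ • Matrix.vecMulVec ψ (star ψ)

/-- The solution `ψ₀ = u₀ ψ_-^{(1)}(t, x, λ₀) + v₀ ψ_+^{(2)}(t, x, λ₀)`. -/
def seedSolution (u : ℝ → ℝ → ℂ) (l₀ u₀ v₀ : ℂ) (t x : ℝ) : Fin 2 → ℂ :=
  u₀ • jostMinus u t x l₀ 0 + v₀ • jostPlus u t x l₀ 1

/-- The matrix `Q[1] = Q[0] - i (λ₀ - λ₀*) [σ₃, P[1]]` produced by the one-fold Darboux transformation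
`D[1] = (λ - λ₀*) 1 + (λ₀* - λ₀) P[1]`. -/
def darbouxMatrix (u : ℝ → ℝ → ℂ) (l₀ u₀ v₀ : ℂ) (t x : ℝ) : Matrix (Fin 2) (Fin 2) ℂ :=
  potentialMatrix (u t x) - (I * (l₀ - conj l₀)) •
    (sigma3 * projector (seedSolution u l₀ u₀ v₀ t x) -
      projector (seedSolution u l₀ u₀ v₀ t x) * sigma3)

/-- The potential `u[1](t, x)` produced by the one-fold Darboux transformation, that is, the upper
right entry of `Q[1]`. -/
def darbouxPotential (u : ℝ → ℝ → ℂ) (l₀ u₀ v₀ : ℂ) (t x : ℝ) : ℂ :=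
  darbouxMatrix u l₀ u₀ v₀ t x 0 1

/-- `Q[1]` is again the matrix of a potential, namely of `u[1]`. -/
theorem darbouxMatrix_eq (u : ℝ → ℝ → ℂ) (l₀ u₀ v₀ : ℂ) (t x : ℝ) :
    darbouxMatrix u l₀ u₀ v₀ t x = potentialMatrix (darbouxPotential u l₀ u₀ v₀ t x) := by
  unfold darbouxPotential darbouxMatrix
  generalize seedSolution u l₀ u₀ v₀ t x = p
  ext i j
  fin_cases i <;> fin_cases j <;>
    simp [potentialMatrix, sigma3, sgn, projector, Matrix.vecMulVec_apply, dotProduct,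
      Fin.sum_univ_two, Matrix.mul_diagonal, Matrix.diagonal_mul]
  ring

end NLSScattering

end

/-!
The Darboux matrix `D = (l - l₀*) 1 + (l₀* - l₀) P` intertwines the Zakharov–Shabat systems of the
potential `w = u(t, ·)` and of its transform `w'`, so it maps Jost solutions to solutions of the new
system. In the coordinates `p = P₁₂` and `q = P₂₂ - P₁₁`, which satisfy `4 |p|² + q² = 1`, the
transform is `w' = w + 4 Im(l₀) p`, and the projector obeys a closed system of differential equations
driven by `w` (`IsDarbouxPair`), from which the intertwining relation is an algebraic identity
(`IsDarbouxPair.isModifiedSolution`).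

Since `a₁₁(l₀) ≠ 0` and `u₀, v₀ ≠ 0`, the seed solution is dominated by `ψ_+^{(2)}` at `-∞` and by
`ψ_-^{(1)}` at `+∞`, hence `q → 1` at `-∞` and `q → -1` at `+∞` (`isDarbouxPair_seedSolution`), and `D`
tends to `diag(l - l₀*, l - l₀)` at `-∞` and to `diag(l - l₀, l - l₀*)` at `+∞`. A Jost column is
characterised as the bounded solution with prescribed limit at one end
(`IsModifiedSolution.isModifiedJostMinus`, `IsModifiedSolution.isModifiedJostPlus`), so the new Jost
columns are `D` applied to the old ones, divided by `l - l₀*` or `l - l₀`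
(`IsDarbouxPair.modifiedJostMinus_eq`, `IsDarbouxPair.modifiedJostPlus_eq`). Together with
`det D = (l - l₀) (l - l₀*)`, and with the fact that `D` annihilates the seed solution at `l = l₀`,
this gives all scattering data, apart from the derivative of the new `a₁₁` at its new zero `l₀`. That
one needs the old `a₁₁` to be continuous at `l₀` (`continuousAt_det_columns_jost`).

Existence, uniqueness and continuity in `l` of the Jost columns all rest on the weight
`e^{2 ∫_{-∞}^x |w|}`, under which the kernel `|w|` has total mass at most `1/2`
(`integral_weight_le`). The reflection `x ↦ -x` reduces the columns normalised at `+∞` to those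
normalised at `-∞`.

That `w'` is in `H^{1,1}(ℝ)` (`IsDarbouxPair.memH11`) follows from
`q' = -8 Im(l₀) |p|² - 4 Re(w* p)`: as `q` is bounded, integration bounds the `L²` norm of `p`, and
integration against `x²`, using that `1 - |q|` is of size `|p|²`, bounds that of `x p`. The equation
of `p` then shows `p' ∈ L²`.
-/

namespace NLSScattering

open Filter Topology

/-! ### The space `H^{1,1}(ℝ)` -/

theorem MemH11.continuous {f : ℝ → ℂ} (hf : MemH11 f) : Continuous f := by
  obtain ⟨-, -, g, hg, h⟩ := hf
  have hli : LocallyIntegrable g volume := hg.locallyIntegrable (by norm_num)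
  have hc : Continuous fun x => ∫ y in (0 : ℝ)..x, g y :=
    intervalIntegral.continuous_primitive (fun a b =>
      (hli.integrableOn_isCompact isCompact_uIcc).intervalIntegrable) 0
  have : f = fun x => f 0 + ∫ y in (0 : ℝ)..x, g y := funext h
  rw [this]
  exact continuous_const.add hc

theorem MemH11.integrable_sq {f : ℝ → ℂ} (hf : MemH11 f) : Integrable fun x => ‖f x‖ ^ 2 :=
  (memLp_two_iff_integrable_sq_norm hf.1.1).1 hf.1

theorem MemH11.integrable_weighted_sq {f : ℝ → ℂ} (hf : MemH11 f) :
    Integrable fun x => x ^ 2 * ‖f x‖ ^ 2 := by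
  have := (memLp_two_iff_integrable_sq_norm hf.2.1.1).1 hf.2.1
  refine this.congr (Eventually.of_forall fun x => ?_)
  simp [mul_pow]

theorem MemH11.integrable {f : ℝ → ℂ} (hf : MemH11 f) : Integrable f := by
  have hb : Integrable fun x : ℝ => (‖f x‖ ^ 2 + x ^ 2 * ‖f x‖ ^ 2) + (1 + x ^ 2)⁻¹ :=
    (hf.integrable_sq.add hf.integrable_weighted_sq).add integrable_inv_one_add_sq
  refine hb.mono' hf.continuous.aestronglyMeasurable (Eventually.of_forall fun x => ?_)
  have hp : (0 : ℝ) < 1 + x ^ 2 := by positivity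
  have h1 : (1 + x ^ 2) * (1 + x ^ 2)⁻¹ = 1 := mul_inv_cancel₀ hp.ne'
  have h2 : 0 < (1 + x ^ 2)⁻¹ := by positivity
  -- the arithmetic-geometric mean inequality for `(1 + x²) |f|²` and `(1 + x²)⁻¹`
  have h3 : 0 ≤ (1 + x ^ 2)⁻¹ * ((1 + x ^ 2) * ‖f x‖ - 1) ^ 2 := by positivity
  have h4 : (1 + x ^ 2)⁻¹ * ((1 + x ^ 2) * ‖f x‖ - 1) ^ 2 =
      (1 + x ^ 2) * ‖f x‖ ^ 2 - 2 * ‖f x‖ + (1 + x ^ 2)⁻¹ := by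
    field_simp
    ring
  nlinarith [norm_nonneg (f x)]

/-! ### Volterra integrals -/

theorem hasDerivAt_integral_Iic {E : Type*} [NormedAddCommGroup E] [NormedSpace ℝ E]
    [CompleteSpace E] {g : ℝ → E} (hg : Continuous g)
    (hi : ∀ x, IntegrableOn g (Set.Iic x)) (x : ℝ) :
    HasDerivAt (fun x => ∫ y in Set.Iic x, g y) (g x) x := by
  have h : (fun x => ∫ y in Set.Iic x, g y) =
      fun x => (∫ y in Set.Iic (0 : ℝ), g y) + ∫ y in (0 : ℝ)..x, g y := by
    funext x
    rw [← intervalIntegral.integral_Iic_sub_Iic (hi 0) (hi x)]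
    abel
  rw [h]
  exact (intervalIntegral.integral_hasDerivAt_right (hg.intervalIntegrable _ _)
    (hg.stronglyMeasurableAtFilter _ _) hg.continuousAt).const_add _

theorem tendsto_integral_Iic_atBot {g : ℝ → ℝ} (hi : Integrable g) :
    Tendsto (fun x => ∫ y in Set.Iic x, g y) atBot (𝓝 0) := by
  have h := tendsto_integral_filter_of_dominated_convergence (μ := volume) (l := atBot)
    (F := fun x : ℝ => (Set.Iic x).indicator g) (f := fun _ => (0 : ℝ)) (fun y => ‖g y‖)
    (Eventually.of_forall fun x => hi.aestronglyMeasurable.indicator measurableSet_Iic)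
    (Eventually.of_forall fun x => Eventually.of_forall fun y => norm_indicator_le_norm_self _ _)
    hi.norm (Eventually.of_forall fun y => by
      refine tendsto_const_nhds.congr' ?_
      filter_upwards [eventually_lt_atBot y] with x hx
      rw [Set.indicator_of_notMem]
      simpa using hx)
  simpa [integral_indicator measurableSet_Iic] using h

/-- The retarded convolution `∫_{-∞}^x e^{c (x - y)} F(y) dy`. -/
noncomputable def duhamel (c : ℂ) (F : ℝ → ℂ) (x : ℝ) : ℂ :=
  ∫ y in Set.Iic x, exp (c * ((x - y : ℝ) : ℂ)) * F y

theorem norm_exp_mul_le_one {c : ℂ} (hc : c.re ≤ 0) {r : ℝ} (hr : 0 ≤ r) :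
    ‖exp (c * (r : ℂ))‖ ≤ 1 := by
  rw [norm_exp, Real.exp_le_one_iff]
  simpa using mul_nonpos_of_nonpos_of_nonneg hc hr

theorem norm_duhamel_integrand_le {c : ℂ} (hc : c.re ≤ 0) (F : ℝ → ℂ) {x y : ℝ} (h : y ≤ x) :
    ‖exp (c * ((x - y : ℝ) : ℂ)) * F y‖ ≤ ‖F y‖ := by
  rw [norm_mul]
  exact mul_le_of_le_one_left (norm_nonneg _) (norm_exp_mul_le_one hc (sub_nonneg.2 h))

theorem integrableOn_duhamel {c : ℂ} (hc : c.re ≤ 0) {F : ℝ → ℂ} (hF : Continuous F)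
    (hi : Integrable F) (x : ℝ) :
    IntegrableOn (fun y : ℝ => exp (c * ((x - y : ℝ) : ℂ)) * F y) (Set.Iic x) := by
  refine Integrable.mono (g := F) hi.integrableOn
    (Continuous.aestronglyMeasurable (by fun_prop)) ?_
  exact (ae_restrict_iff' measurableSet_Iic).2 (Eventually.of_forall fun y hy =>
    norm_duhamel_integrand_le hc F hy)

theorem norm_duhamel_le {c : ℂ} (hc : c.re ≤ 0) {F : ℝ → ℂ}
    (hi : Integrable F) (x : ℝ) : ‖duhamel c F x‖ ≤ ∫ y in Set.Iic x, ‖F y‖ := by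
  refine norm_integral_le_of_norm_le hi.norm.integrableOn ?_
  exact (ae_restrict_iff' measurableSet_Iic).2 (Eventually.of_forall fun y hy =>
    norm_duhamel_integrand_le hc F hy)

theorem hasDerivAt_duhamel {c : ℂ} (hc : c.re ≤ 0) {F : ℝ → ℂ} (hF : Continuous F)
    (hi : Integrable F) (x : ℝ) :
    HasDerivAt (duhamel c F) (c * duhamel c F x + F x) x := by
  have hsplit : ∀ x y : ℝ, exp (c * ((x - y : ℝ) : ℂ)) * F y =
      exp (c * x) * (exp (-(c * y)) * F y) := by
    intro x y
    rw [← mul_assoc, ← exp_add]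
    congr 2
    push_cast
    ring
  have hint : ∀ x, IntegrableOn (fun y : ℝ => exp (-(c * y)) * F y) (Set.Iic x) := by
    intro x
    have := (integrableOn_duhamel hc hF hi x).const_mul (exp (-(c * x)))
    refine this.congr (Eventually.of_forall fun y => ?_)
    simp only [hsplit, ← mul_assoc, ← exp_add]
    simp
  have hv : duhamel c F = fun x : ℝ =>
      exp (c * x) * ∫ y in Set.Iic x, exp (-(c * y)) * F y := by
    funext x
    simp only [duhamel, hsplit]
    rw [integral_const_mul]
  have hd := hasDerivAt_integral_Iic (g := fun y : ℝ => exp (-(c * y)) * F y) (by fun_prop) hint x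
  have he : HasDerivAt (fun x : ℝ => exp (c * x)) (exp (c * x) * c) x := by
    have h1 : HasDerivAt (fun x : ℝ => c * (x : ℂ)) (c * 1) x :=
      (hasDerivAt_id x).ofReal_comp.const_mul c
    simpa using h1.cexp
  rw [hv]
  refine (he.mul hd).congr_deriv ?_
  have hxx := hsplit x x
  simp only [sub_self, ofReal_zero, mul_zero, exp_zero, one_mul] at hxx
  rw [← hxx]
  ring

theorem tendsto_duhamel_atBot {c : ℂ} (hc : c.re ≤ 0) {F : ℝ → ℂ}
    (hi : Integrable F) : Tendsto (duhamel c F) atBot (𝓝 0) :=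
  squeeze_zero_norm (norm_duhamel_le hc hi) (tendsto_integral_Iic_atBot hi.norm)

/-- A strictly decaying exponential makes the retarded convolution with an integrable function vanish
at `+∞`, by dominated convergence. -/
theorem tendsto_duhamel_atTop {c : ℂ} (hc : c.re < 0) {F : ℝ → ℂ} (hF : Continuous F)
    (hi : Integrable F) : Tendsto (duhamel c F) atTop (𝓝 0) := by
  have h := tendsto_integral_filter_of_dominated_convergence (μ := volume) (l := atTop)
    (F := fun x : ℝ => (Set.Iic x).indicator fun y : ℝ => exp (c * ((x - y : ℝ) : ℂ)) * F y)
    (f := fun _ => (0 : ℂ)) (fun y => ‖F y‖)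
    (Eventually.of_forall fun x =>
      (Continuous.aestronglyMeasurable (by fun_prop)).indicator measurableSet_Iic)
    (Eventually.of_forall fun x => Eventually.of_forall fun y => by
      by_cases hy : y ∈ Set.Iic x
      · rw [Set.indicator_of_mem hy]
        exact norm_duhamel_integrand_le hc.le F hy
      · rw [Set.indicator_of_notMem hy]
        simp)
    hi.norm (Eventually.of_forall fun y => by
      refine squeeze_zero_norm (a := fun x : ℝ => Real.exp (c.re * (x - y)) * ‖F y‖)
        (fun x => ?_) ?_
      · refine (norm_indicator_le_norm_self _ _).trans ?_
        rw [norm_mul, norm_exp]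
        simp
      · have h1 : Tendsto (fun x : ℝ => c.re * (x - y)) atTop atBot :=
          (tendsto_atTop_add_const_right _ (-y) tendsto_id).const_mul_atTop_of_neg hc
        simpa using (Real.tendsto_exp_atBot.comp h1).mul_const ‖F y‖)
  simp only [integral_indicator measurableSet_Iic, integral_zero] at h
  exact h

/-! ### A Gronwall inequality with integrable kernel -/

/-- The total mass `∫_{-∞}^x |w|` of the potential to the left of `x`. -/
noncomputable def mass (w : ℝ → ℂ) (x : ℝ) : ℝ := ∫ y in Set.Iic x, ‖w y‖

theorem mass_nonneg (w : ℝ → ℂ) (x : ℝ) : 0 ≤ mass w x :=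
  integral_nonneg fun _ => norm_nonneg _

theorem mass_le {w : ℝ → ℂ} (hi : Integrable w) (x : ℝ) : mass w x ≤ ∫ y, ‖w y‖ :=
  setIntegral_le_integral hi.norm (Eventually.of_forall fun _ => norm_nonneg _)

theorem hasDerivAt_mass {w : ℝ → ℂ} (hw : Continuous w) (hi : Integrable w) (x : ℝ) :
    HasDerivAt (mass w) ‖w x‖ x :=
  hasDerivAt_integral_Iic hw.norm (fun _ => hi.norm.integrableOn) x

theorem continuous_mass {w : ℝ → ℂ} (hw : Continuous w) (hi : Integrable w) :
    Continuous (mass w) :=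
  continuous_iff_continuousAt.2 fun x => (hasDerivAt_mass hw hi x).continuousAt

theorem integrable_weight {w : ℝ → ℂ} (hw : Continuous w) (hi : Integrable w) :
    Integrable fun y => ‖w y‖ * Real.exp (2 * mass w y) := by
  refine (hi.norm.mul_const (Real.exp (2 * ∫ y, ‖w y‖))).mono'
    (Continuous.aestronglyMeasurable ?_) (Eventually.of_forall fun y => ?_)
  · have := continuous_mass hw hi
    fun_prop
  · rw [Real.norm_of_nonneg (by positivity)]
    have := mass_le hi y
    gcongr

/-- The weight `e^{2 ∫_{-∞}^x |w|}` turns the kernel `|w|` into one of total mass at most `1/2`. -/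
theorem integral_weight_le {w : ℝ → ℂ} (hw : Continuous w) (hi : Integrable w) (x : ℝ) :
    ∫ y in Set.Iic x, ‖w y‖ * Real.exp (2 * mass w y) ≤ Real.exp (2 * mass w x) / 2 := by
  have hd : ∀ y : ℝ, HasDerivAt (fun y => Real.exp (2 * mass w y) / 2)
      (‖w y‖ * Real.exp (2 * mass w y)) y := by
    intro y
    refine ((((hasDerivAt_mass hw hi y).const_mul 2).exp).div_const 2).congr_deriv ?_
    ring
  have hlim : Tendsto (fun y => Real.exp (2 * mass w y) / 2) atBot (𝓝 (1 / 2)) := by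
    have h0 : Tendsto (mass w) atBot (𝓝 0) := tendsto_integral_Iic_atBot hi.norm
    have := ((Real.continuous_exp.tendsto _).comp (h0.const_mul 2)).div_const 2
    simpa using this
  rw [integral_Iic_of_hasDerivAt_of_tendsto' (fun y _ => hd y)
    (integrable_weight hw hi).integrableOn hlim]
  linarith

/-- Gronwall's inequality on `(-∞, x]`, in the non-sharp form that the weight
`e^{2 ∫_{-∞}^x |w|}` gives: its weighted supremum `B` satisfies `B ≤ F + B / 2`. -/
theorem gronwall_Iic {w : ℝ → ℂ} (hw : Continuous w) (hi : Integrable w) {d : ℝ → ℝ}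
    (hd : Continuous d) (hd0 : ∀ x, 0 ≤ d x) {K : ℝ} (hK : ∀ x, d x ≤ K) {F : ℝ} (hF : 0 ≤ F)
    (h : ∀ x, d x ≤ F + ∫ y in Set.Iic x, ‖w y‖ * d y) (x : ℝ) :
    d x ≤ 2 * F * Real.exp (2 * mass w x) := by
  have hbdd : BddAbove (Set.range fun x => d x * Real.exp (-(2 * mass w x))) := by
    refine ⟨K, ?_⟩
    rintro _ ⟨y, rfl⟩
    have h1 : Real.exp (-(2 * mass w y)) ≤ 1 := by
      rw [Real.exp_le_one_iff]
      linarith [mass_nonneg w y]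
    exact (mul_le_of_le_one_right (hd0 y) h1).trans (hK y)
  set B := ⨆ x, d x * Real.exp (-(2 * mass w x)) with hB
  have hle : ∀ y, d y ≤ B * Real.exp (2 * mass w y) := by
    intro y
    have h1 := le_ciSup hbdd y
    calc d y = d y * Real.exp (-(2 * mass w y)) * Real.exp (2 * mass w y) := by
          rw [mul_assoc, ← Real.exp_add]
          simp
      _ ≤ _ := by gcongr
  have hint : Integrable fun y => ‖w y‖ * d y := by
    refine (hi.norm.mul_const K).mono' (by fun_prop) (Eventually.of_forall fun y => ?_)
    rw [Real.norm_of_nonneg (mul_nonneg (norm_nonneg _) (hd0 y))]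
    have := hK y
    gcongr
  have hB0 : 0 ≤ B := Real.iSup_nonneg fun y => mul_nonneg (hd0 y) (Real.exp_pos _).le
  have hstep : ∀ y, d y * Real.exp (-(2 * mass w y)) ≤ F + B / 2 := by
    intro y
    have h1 : ∫ z in Set.Iic y, ‖w z‖ * d z ≤ B * (Real.exp (2 * mass w y) / 2) := by
      refine le_trans ?_ (mul_le_mul_of_nonneg_left (integral_weight_le hw hi y) hB0)
      rw [← integral_const_mul]
      refine integral_mono hint.integrableOn ((integrable_weight hw hi).const_mul B).integrableOn
        fun z => ?_
      calc ‖w z‖ * d z ≤ ‖w z‖ * (B * Real.exp (2 * mass w z)) := by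
            gcongr
            exact hle z
        _ = _ := by ring
    have h2 : Real.exp (-(2 * mass w y)) ≤ 1 := by
      rw [Real.exp_le_one_iff]
      linarith [mass_nonneg w y]
    calc d y * Real.exp (-(2 * mass w y))
        ≤ (F + B * (Real.exp (2 * mass w y) / 2)) * Real.exp (-(2 * mass w y)) := by
          gcongr
          exact (h y).trans (by linarith)
      _ = F * Real.exp (-(2 * mass w y)) +
          B / 2 * (Real.exp (2 * mass w y) * Real.exp (-(2 * mass w y))) := by ring
      _ = F * Real.exp (-(2 * mass w y)) + B / 2 := by
          rw [← Real.exp_add]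
          simp
      _ ≤ F + B / 2 := by
          gcongr
          exact mul_le_of_le_one_right hF h2
  have hB2 : B ≤ F + B / 2 := ciSup_le hstep
  refine (hle x).trans ?_
  gcongr
  linarith

/-! ### Existence and uniqueness of the modified Jost solutions -/

theorem potentialMatrix_mulVec_zero (z : ℂ) (v : Fin 2 → ℂ) :
    (potentialMatrix z *ᵥ v) 0 = z * v 1 := by
  simp [potentialMatrix, Matrix.mulVec, dotProduct, Fin.sum_univ_two]

theorem potentialMatrix_mulVec_one (z : ℂ) (v : Fin 2 → ℂ) :
    (potentialMatrix z *ᵥ v) 1 = -conj z * v 0 := by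
  simp [potentialMatrix, Matrix.mulVec, dotProduct, Fin.sum_univ_two]

theorem norm_potentialMatrix_mulVec_le (z : ℂ) (v : Fin 2 → ℂ) (i : Fin 2) :
    ‖(potentialMatrix z *ᵥ v) i‖ ≤ ‖z‖ * ‖v‖ := by
  fin_cases i
  · simp only [Fin.zero_eta, potentialMatrix_mulVec_zero, norm_mul]
    gcongr
    exact norm_le_pi_norm v 1
  · simp only [Fin.mk_one, potentialMatrix_mulVec_one, norm_mul, norm_neg, RCLike.norm_conj]
    gcongr
    exact norm_le_pi_norm v 0

theorem continuous_potentialMatrix_mulVec {w : ℝ → ℂ} (hw : Continuous w) {m : ℝ → Fin 2 → ℂ}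
    (hm : Continuous m) (i : Fin 2) : Continuous fun y => (potentialMatrix (w y) *ᵥ m y) i := by
  fin_cases i
  · simp only [Fin.zero_eta, potentialMatrix_mulVec_zero]
    fun_prop
  · simp only [Fin.mk_one, potentialMatrix_mulVec_one]
    have := continuous_conj.comp hw
    exact this.neg.mul (by fun_prop)

theorem integrable_potentialMatrix_mulVec {w : ℝ → ℂ} (hw : Continuous w) (hi : Integrable w)
    {m : ℝ → Fin 2 → ℂ} (hm : Continuous m) {K : ℝ} (hK : ∀ x, ‖m x‖ ≤ K) (i : Fin 2) :
    Integrable fun y => (potentialMatrix (w y) *ᵥ m y) i := by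
  refine (hi.norm.mul_const K).mono'
    (continuous_potentialMatrix_mulVec hw hm i).aestronglyMeasurable
    (Eventually.of_forall fun y => (norm_potentialMatrix_mulVec_le _ _ _).trans ?_)
  have := hK y
  gcongr

/-- The exponential rate of the `i`-th component of the `j`-th modified Jost column at `l`. -/
def rate (l : ℂ) (j i : Fin 2) : ℂ := -(I * l * (sgn i - sgn j))

@[simp] theorem rate_self (l : ℂ) (j : Fin 2) : rate l j j = 0 := by simp [rate]

theorem rate_zero_one (l : ℂ) : rate l 0 1 = 2 * I * l := by
  simp [rate, sgn]
  ring

/-- The pairs `(l, j)` for which the `j`-th column of `m_-` is defined at `l`, encoded by the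
exponentials in its integral equation being bounded. -/
def Admissible (l : ℂ) (j : Fin 2) : Prop := ∀ i, (rate l j i).re ≤ 0

theorem admissible_zero {l : ℂ} (hl : 0 ≤ l.im) : Admissible l 0 := by
  intro i
  fin_cases i
  · simp [rate]
  · simp only [Fin.mk_one, rate_zero_one]
    simpa using hl

theorem admissible_ofReal (ξ : ℝ) (j : Fin 2) : Admissible ξ j := by
  intro i
  fin_cases i <;> fin_cases j <;> simp [rate, sgn]

theorem isModifiedJostMinus_iff {w : ℝ → ℂ} {l : ℂ} {j : Fin 2} {m : ℝ → Fin 2 → ℂ} :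
    IsModifiedJostMinus w l j m ↔ Continuous m ∧ (∃ K : ℝ, ∀ x, ‖m x‖ ≤ K) ∧
      ∀ x i, m x i = (if i = j then 1 else 0) +
        duhamel (rate l j i) (fun y => (potentialMatrix (w y) *ᵥ m y) i) x := by
  have key : ∀ (x : ℝ) (i : Fin 2), (∫ y in Set.Iic x, exp (-(I * theta 0 (x - y) l * sgn i)) *
        (potentialMatrix (w y) *ᵥ m y) i * exp (I * theta 0 (x - y) l * sgn j)) =
      duhamel (rate l j i) (fun y => (potentialMatrix (w y) *ᵥ m y) i) x := by
    intro x i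
    unfold duhamel
    congr 1
    funext y
    rw [mul_right_comm, ← exp_add]
    congr 2
    simp only [theta, rate]
    push_cast
    ring
  constructor
  · rintro ⟨h1, h2, h3⟩
    exact ⟨h1, h2, fun x i => by rw [h3, key]⟩
  · rintro ⟨h1, h2, h3⟩
    exact ⟨h1, h2, fun x i => by rw [h3 x i, key]⟩

theorem duhamel_sub {c : ℂ} (hc : c.re ≤ 0) {F G : ℝ → ℂ} (hF : Continuous F)
    (hFi : Integrable F) (hG : Continuous G) (hGi : Integrable G) (x : ℝ) :
    duhamel c F x - duhamel c G x = duhamel c (fun y => F y - G y) x := by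
  unfold duhamel
  rw [← integral_sub (integrableOn_duhamel hc hF hFi x) (integrableOn_duhamel hc hG hGi x)]
  simp only [mul_sub]

theorem IsModifiedJostMinus.unique {w : ℝ → ℂ} (hw : Continuous w) (hi : Integrable w) {l : ℂ}
    {j : Fin 2} (hlj : Admissible l j) {m n : ℝ → Fin 2 → ℂ} (hm : IsModifiedJostMinus w l j m)
    (hn : IsModifiedJostMinus w l j n) : m = n := by
  obtain ⟨hmc, ⟨K, hK⟩, hmv⟩ := isModifiedJostMinus_iff.1 hm
  obtain ⟨hnc, ⟨L, hL⟩, hnv⟩ := isModifiedJostMinus_iff.1 hn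
  have hbd : ∀ x, ‖m x - n x‖ ≤ K + L := fun x =>
    (norm_sub_le _ _).trans (add_le_add (hK x) (hL x))
  have hint : Integrable fun y => ‖w y‖ * ‖m y - n y‖ := by
    refine (hi.norm.mul_const (K + L)).mono' (by fun_prop) (Eventually.of_forall fun y => ?_)
    rw [Real.norm_of_nonneg (by positivity)]
    have := hbd y
    gcongr
  have h := gronwall_Iic hw hi (d := fun x => ‖m x - n x‖) (by fun_prop)
    (fun x => norm_nonneg _) hbd le_rfl (fun x => by
      rw [zero_add, pi_norm_le_iff_of_nonneg (integral_nonneg fun y => by positivity)]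
      intro i
      rw [Pi.sub_apply, hmv, hnv, add_sub_add_left_eq_sub, duhamel_sub (hlj i)
        (continuous_potentialMatrix_mulVec hw hmc i)
        (integrable_potentialMatrix_mulVec hw hi hmc hK i)
        (continuous_potentialMatrix_mulVec hw hnc i)
        (integrable_potentialMatrix_mulVec hw hi hnc hL i)]
      refine (norm_duhamel_le (hlj i) ((integrable_potentialMatrix_mulVec hw hi hmc hK i).sub
        (integrable_potentialMatrix_mulVec hw hi hnc hL i)) x).trans ?_
      refine integral_mono (((integrable_potentialMatrix_mulVec hw hi hmc hK i).sub
        (integrable_potentialMatrix_mulVec hw hi hnc hL i)).norm.integrableOn)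
        hint.integrableOn fun y => ?_
      change ‖(potentialMatrix (w y) *ᵥ m y) i - (potentialMatrix (w y) *ᵥ n y) i‖ ≤ _
      rw [← Pi.sub_apply, ← Matrix.mulVec_sub]
      exact norm_potentialMatrix_mulVec_le _ _ _)
  funext x
  have := h x
  simp only [mul_zero, zero_mul, norm_le_zero_iff] at this
  exact sub_eq_zero.1 this

theorem norm_duhamel_le_of_weight {w : ℝ → ℂ} (hw : Continuous w) (hi : Integrable w) {c : ℂ}
    (hc : c.re ≤ 0) {F : ℝ → ℂ} (hF : Continuous F) {B : ℝ} (hB : 0 ≤ B)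
    (h : ∀ y, ‖F y‖ ≤ B * (‖w y‖ * Real.exp (2 * mass w y))) (x : ℝ) :
    ‖duhamel c F x‖ ≤ B * (Real.exp (2 * mass w x) / 2) := by
  have hFi : Integrable F :=
    ((integrable_weight hw hi).const_mul B).mono' hF.aestronglyMeasurable (Eventually.of_forall h)
  refine (norm_duhamel_le hc hFi x).trans ?_
  refine le_trans (integral_mono hFi.norm.integrableOn
    ((integrable_weight hw hi).const_mul B).integrableOn h) ?_
  rw [integral_const_mul]
  exact mul_le_mul_of_nonneg_left (integral_weight_le hw hi x) hB

/-- The integral equation of a Jost column is solved by Banach's fixed point theorem: conjugated by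
the weight `e^{2 ∫_{-∞}^x |w|}` it is a contraction of the bounded continuous functions. -/
theorem exists_isModifiedJostMinus {w : ℝ → ℂ} (hw : Continuous w) (hi : Integrable w) {l : ℂ}
    {j : Fin 2} (hlj : Admissible l j) : ∃ m, IsModifiedJostMinus w l j m := by
  have hM := continuous_mass hw hi
  let src : BoundedContinuousFunction ℝ (Fin 2 → ℂ) → Fin 2 → ℝ → ℂ := fun n i y =>
    (potentialMatrix (w y) *ᵥ (((Real.exp (2 * mass w y) : ℝ) : ℂ) • n y)) i
  have hexp : Continuous fun y => ((Real.exp (2 * mass w y) : ℝ) : ℂ) := by fun_prop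
  have hsrcC : ∀ n i, Continuous (src n i) := fun n i =>
    continuous_potentialMatrix_mulVec hw (hexp.smul n.continuous) i
  have hsub : ∀ n n' i y, src n i y - src n' i y = src (n - n') i y := by
    intro n n' i y
    simp only [src, BoundedContinuousFunction.coe_sub, Pi.sub_apply, smul_sub, Matrix.mulVec_sub]
  have hsrcB : ∀ n i y, ‖src n i y‖ ≤ ‖n‖ * (‖w y‖ * Real.exp (2 * mass w y)) := by
    intro n i y
    refine (norm_potentialMatrix_mulVec_le _ _ _).trans ?_
    rw [norm_smul, norm_real, Real.norm_of_nonneg (Real.exp_pos _).le]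
    calc ‖w y‖ * (Real.exp (2 * mass w y) * ‖n y‖)
        ≤ ‖w y‖ * (Real.exp (2 * mass w y) * ‖n‖) := by
          gcongr
          exact n.norm_coe_le_norm y
      _ = _ := by ring
  have hsrcI : ∀ n i, Integrable (src n i) := fun n i =>
    ((integrable_weight hw hi).const_mul ‖n‖).mono' (hsrcC n i).aestronglyMeasurable
      (Eventually.of_forall (hsrcB n i))
  have hee : ∀ x, Real.exp (-(2 * mass w x)) * Real.exp (2 * mass w x) = 1 := by
    intro x
    rw [← Real.exp_add]
    simp
  have he1 : ∀ x, Real.exp (-(2 * mass w x)) ≤ 1 := by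
    intro x
    rw [Real.exp_le_one_iff]
    linarith [mass_nonneg w x]
  let f : BoundedContinuousFunction ℝ (Fin 2 → ℂ) → ℝ → Fin 2 → ℂ := fun n x i =>
    ((Real.exp (-(2 * mass w x)) : ℝ) : ℂ) *
      ((if i = j then 1 else 0) + duhamel (rate l j i) (src n i) x)
  have hfC : ∀ n, Continuous (f n) := by
    intro n
    refine continuous_pi fun i => ?_
    have hv : Continuous (duhamel (rate l j i) (src n i)) := continuous_iff_continuousAt.2
      fun x => (hasDerivAt_duhamel (hlj i) (hsrcC n i) (hsrcI n i) x).continuousAt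
    have he : Continuous fun y => ((Real.exp (-(2 * mass w y)) : ℝ) : ℂ) := by fun_prop
    exact he.mul (continuous_const.add hv)
  have hvol : ∀ n i x, Real.exp (-(2 * mass w x)) * ‖duhamel (rate l j i) (src n i) x‖ ≤
      ‖n‖ / 2 := by
    intro n i x
    calc Real.exp (-(2 * mass w x)) * ‖duhamel (rate l j i) (src n i) x‖
        ≤ Real.exp (-(2 * mass w x)) * (‖n‖ * (Real.exp (2 * mass w x) / 2)) := by
          gcongr
          exact norm_duhamel_le_of_weight hw hi (hlj i) (hsrcC n i) (norm_nonneg n) (hsrcB n i) x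
      _ = ‖n‖ / 2 * (Real.exp (-(2 * mass w x)) * Real.exp (2 * mass w x)) := by ring
      _ = ‖n‖ / 2 := by rw [hee, mul_one]
  have hfB : ∀ n x, ‖f n x‖ ≤ 1 + ‖n‖ / 2 := by
    intro n x
    refine (pi_norm_le_iff_of_nonneg (by positivity)).2 fun i => ?_
    simp only [f, norm_mul, norm_real, Real.norm_of_nonneg (Real.exp_pos _).le]
    have h1 : ‖(if i = j then (1 : ℂ) else 0)‖ ≤ 1 := by split_ifs <;> simp
    calc Real.exp (-(2 * mass w x)) *
          ‖(if i = j then (1 : ℂ) else 0) + duhamel (rate l j i) (src n i) x‖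
        ≤ Real.exp (-(2 * mass w x)) *
          (‖(if i = j then (1 : ℂ) else 0)‖ + ‖duhamel (rate l j i) (src n i) x‖) := by
          gcongr
          exact norm_add_le _ _
      _ ≤ 1 * 1 + ‖n‖ / 2 := by
          rw [mul_add]
          exact add_le_add (mul_le_mul (he1 x) h1 (norm_nonneg _) zero_le_one) (hvol n i x)
      _ = 1 + ‖n‖ / 2 := by ring
  let T : BoundedContinuousFunction ℝ (Fin 2 → ℂ) → BoundedContinuousFunction ℝ (Fin 2 → ℂ) :=
    fun n => BoundedContinuousFunction.ofNormedAddCommGroup (f n) (hfC n) (1 + ‖n‖ / 2) (hfB n)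
  have hT : ContractingWith (1 / 2) T := by
    refine ⟨by
      rw [← NNReal.coe_lt_coe]
      norm_num, LipschitzWith.of_dist_le_mul fun n n' => ?_⟩
    rw [BoundedContinuousFunction.dist_le (by positivity)]
    intro x
    rw [dist_eq_norm, dist_eq_norm]
    refine (pi_norm_le_iff_of_nonneg (by positivity)).2 fun i => ?_
    have h1 : (T n x - T n' x) i = ((Real.exp (-(2 * mass w x)) : ℝ) : ℂ) *
        duhamel (rate l j i) (src (n - n') i) x := by
      have h2 := duhamel_sub (hlj i) (hsrcC n i) (hsrcI n i) (hsrcC n' i) (hsrcI n' i) x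
      simp only [hsub] at h2
      change f n x i - f n' x i = _
      rw [show src (n - n') i = fun y => src (n - n') i y from rfl, ← h2]
      simp only [f]
      ring
    rw [h1, norm_mul, norm_real, Real.norm_of_nonneg (Real.exp_pos _).le]
    refine (hvol (n - n') i x).trans (le_of_eq ?_)
    push_cast
    ring
  set n := hT.fixedPoint T with hn
  have hfix : T n = n := hT.fixedPoint_isFixedPt
  refine ⟨fun x => ((Real.exp (2 * mass w x) : ℝ) : ℂ) • n x, isModifiedJostMinus_iff.2
    ⟨hexp.smul n.continuous, ⟨Real.exp (2 * ∫ y, ‖w y‖) * ‖n‖, fun x => ?_⟩, fun x i => ?_⟩⟩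
  · rw [norm_smul, norm_real, Real.norm_of_nonneg (Real.exp_pos _).le]
    have := mass_le hi x
    have := n.norm_coe_le_norm x
    gcongr
  · have h1 : n x i = f n x i := by
      conv_lhs => rw [← hfix]
      rfl
    have h2 : ((Real.exp (2 * mass w x) : ℝ) : ℂ) * ((Real.exp (-(2 * mass w x)) : ℝ) : ℂ) = 1 := by
      rw [← ofReal_mul, mul_comm, hee, ofReal_one]
    rw [Pi.smul_apply, smul_eq_mul, h1]
    simp only [f]
    rw [← mul_assoc, h2, one_mul]

theorem isModifiedJostMinus_modifiedJostMinus {w : ℝ → ℂ} (hw : Continuous w) (hi : Integrable w)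
    {l : ℂ} {j : Fin 2} (hlj : Admissible l j) :
    IsModifiedJostMinus w l j (modifiedJostMinus w l j) :=
  Classical.epsilon_spec (exists_isModifiedJostMinus hw hi hlj)

/-! ### The Jost columns as solutions of the Zakharov–Shabat system -/

/-- A modified Jost column solves the Zakharov–Shabat system in the modified form
`m_i' = -i l (s_i - s_j) m_i + (Q m)_i`. -/
def IsModifiedSolution (w : ℝ → ℂ) (l : ℂ) (j : Fin 2) (m : ℝ → Fin 2 → ℂ) : Prop :=
  ∀ x i, HasDerivAt (fun y => m y i) (rate l j i * m x i + (potentialMatrix (w x) *ᵥ m x) i) x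

theorem IsModifiedJostMinus.isModifiedSolution {w : ℝ → ℂ} (hw : Continuous w)
    (hi : Integrable w) {l : ℂ} {j : Fin 2} (hlj : Admissible l j) {m : ℝ → Fin 2 → ℂ}
    (hm : IsModifiedJostMinus w l j m) : IsModifiedSolution w l j m := by
  obtain ⟨hc, ⟨K, hK⟩, hv⟩ := isModifiedJostMinus_iff.1 hm
  intro x i
  have h1 := hasDerivAt_duhamel (hlj i) (continuous_potentialMatrix_mulVec hw hc i)
    (integrable_potentialMatrix_mulVec hw hi hc hK i) x
  have h2 : (fun y => m y i) = fun y => (if i = j then 1 else 0) +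
      duhamel (rate l j i) (fun y => (potentialMatrix (w y) *ᵥ m y) i) y :=
    funext fun y => hv y i
  rw [h2]
  refine (h1.const_add _).congr_deriv ?_
  rw [hv x i]
  split_ifs with h
  · subst h
    simp
  · simp

theorem IsModifiedJostMinus.tendsto_atBot {w : ℝ → ℂ} (hw : Continuous w)
    (hi : Integrable w) {l : ℂ} {j : Fin 2} (hlj : Admissible l j) {m : ℝ → Fin 2 → ℂ}
    (hm : IsModifiedJostMinus w l j m) (i : Fin 2) :
    Tendsto (fun x => m x i) atBot (𝓝 (if i = j then 1 else 0)) := by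
  obtain ⟨hc, ⟨K, hK⟩, hv⟩ := isModifiedJostMinus_iff.1 hm
  simp only [hv]
  simpa using (tendsto_duhamel_atBot (hlj i)
    (integrable_potentialMatrix_mulVec hw hi hc hK i)).const_add (if i = j then (1 : ℂ) else 0)

/-- In the open upper half-plane the exponent in the second component of the first Jost column is
strictly decaying, so this component vanishes also at `+∞`. -/
theorem IsModifiedJostMinus.tendsto_atTop_one {w : ℝ → ℂ} (hw : Continuous w)
    (hi : Integrable w) {l : ℂ} (hl : 0 < l.im) {m : ℝ → Fin 2 → ℂ}
    (hm : IsModifiedJostMinus w l 0 m) : Tendsto (fun x => m x 1) atTop (𝓝 0) := by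
  obtain ⟨hc, ⟨K, hK⟩, hv⟩ := isModifiedJostMinus_iff.1 hm
  simp only [hv]
  have hr : (rate l 0 1).re < 0 := by
    rw [rate_zero_one]
    simpa using hl
  simpa using tendsto_duhamel_atTop hr (continuous_potentialMatrix_mulVec hw hc 1)
    (integrable_potentialMatrix_mulVec hw hi hc hK 1)

/-- A bounded solution of the modified Zakharov–Shabat system with the right limit at `-∞` is the
modified Jost column. -/
theorem IsModifiedSolution.isModifiedJostMinus {w : ℝ → ℂ} (hw : Continuous w)
    (hi : Integrable w) {l : ℂ} {j : Fin 2} (hlj : Admissible l j) {m : ℝ → Fin 2 → ℂ}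
    (hm : IsModifiedSolution w l j m) {K : ℝ} (hK : ∀ x, ‖m x‖ ≤ K)
    (hlim : ∀ i, Tendsto (fun x => m x i) atBot (𝓝 (if i = j then 1 else 0))) :
    IsModifiedJostMinus w l j m := by
  have hc : Continuous m := continuous_pi fun i =>
    continuous_iff_continuousAt.2 fun x => (hm x i).continuousAt
  refine isModifiedJostMinus_iff.2 ⟨hc, ⟨K, hK⟩, fun x i => ?_⟩
  -- variation of constants: `e^{c (x - y)} m_i(y)` has derivative `e^{c (x - y)} (Q m)_i(y)`
  have hd : ∀ y : ℝ, HasDerivAt (fun y : ℝ => exp (rate l j i * ((x - y : ℝ) : ℂ)) * m y i)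
      (exp (rate l j i * ((x - y : ℝ) : ℂ)) * (potentialMatrix (w y) *ᵥ m y) i) y := by
    intro y
    have h1 : HasDerivAt (fun y : ℝ => rate l j i * ((x - y : ℝ) : ℂ)) (rate l j i * (-1)) y := by
      have := (((hasDerivAt_id y).const_sub x).ofReal_comp).const_mul (rate l j i)
      simpa using this
    refine (h1.cexp.mul (hm y i)).congr_deriv ?_
    ring
  have hlim' : Tendsto (fun y : ℝ => exp (rate l j i * ((x - y : ℝ) : ℂ)) * m y i) atBot
      (𝓝 (if i = j then 1 else 0)) := by
    by_cases h : i = j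
    · subst h
      simpa using hlim i
    · have h0 := hlim i
      rw [if_neg h] at h0 ⊢
      refine squeeze_zero_norm' ?_ (by simpa using h0.norm)
      filter_upwards [eventually_le_atBot x] with y hy
      rw [norm_mul]
      exact mul_le_of_le_one_left (norm_nonneg _) (norm_exp_mul_le_one (hlj i) (sub_nonneg.2 hy))
  have hFTC := integral_Iic_of_hasDerivAt_of_tendsto' (fun y _ => hd y)
    (integrableOn_duhamel (hlj i) (continuous_potentialMatrix_mulVec hw hc i)
      (integrable_potentialMatrix_mulVec hw hi hc hK i) x) hlim'
  rw [duhamel, hFTC]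
  simp

/-! ### Reflection -/

/-- The reflected potential `x ↦ w(-x)*`. -/
def reflect (w : ℝ → ℂ) (x : ℝ) : ℂ := conj (w (-x))

/-- The reflected vector function: `x ↦ m(-x)` with the two components exchanged. -/
def reflectSol (m : ℝ → Fin 2 → ℂ) (x : ℝ) (i : Fin 2) : ℂ := m (-x) i.rev

theorem reflect_reflect (w : ℝ → ℂ) : reflect (reflect w) = w := by
  funext x
  simp [reflect]

theorem reflectSol_reflectSol (m : ℝ → Fin 2 → ℂ) : reflectSol (reflectSol m) = m := by
  funext x i
  simp [reflectSol]

theorem continuous_reflect {w : ℝ → ℂ} (hw : Continuous w) : Continuous (reflect w) :=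
  continuous_conj.comp (hw.comp continuous_neg)

theorem integrable_reflect {w : ℝ → ℂ} (hi : Integrable w) : Integrable (reflect w) :=
  hi.comp_neg.congr'
    (continuous_conj.comp_aestronglyMeasurable hi.comp_neg.aestronglyMeasurable)
    (Eventually.of_forall fun x => by simp [reflect])

theorem continuous_reflectSol {m : ℝ → Fin 2 → ℂ} (hm : Continuous m) :
    Continuous (reflectSol m) := by
  refine continuous_pi fun i => ?_
  unfold reflectSol
  fun_prop

theorem norm_reflectSol_le (m : ℝ → Fin 2 → ℂ) (x : ℝ) : ‖reflectSol m x‖ ≤ ‖m (-x)‖ :=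
  (pi_norm_le_iff_of_nonneg (norm_nonneg _)).2 fun i => norm_le_pi_norm (m (-x)) i.rev

theorem sgn_rev (i : Fin 2) : sgn i.rev = -sgn i := by
  fin_cases i <;> simp [sgn, Fin.rev]

theorem rate_rev (l : ℂ) (j i : Fin 2) : rate l j.rev i.rev = -rate l j i := by
  simp only [rate, sgn_rev]
  ring

theorem potentialMatrix_reflect_mulVec (w : ℝ → ℂ) (m : ℝ → Fin 2 → ℂ) (x : ℝ) (i : Fin 2) :
    (potentialMatrix (reflect w x) *ᵥ reflectSol m x) i =
      -(potentialMatrix (w (-x)) *ᵥ m (-x)) i.rev := by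
  fin_cases i
  · change (potentialMatrix (reflect w x) *ᵥ reflectSol m x) 0 =
      -(potentialMatrix (w (-x)) *ᵥ m (-x)) 1
    rw [potentialMatrix_mulVec_zero, potentialMatrix_mulVec_one]
    simp [reflect, reflectSol]
  · change (potentialMatrix (reflect w x) *ᵥ reflectSol m x) 1 =
      -(potentialMatrix (w (-x)) *ᵥ m (-x)) 0
    rw [potentialMatrix_mulVec_zero, potentialMatrix_mulVec_one]
    simp [reflect, reflectSol]

/-- Reflection turns the Jost columns normalised at `+∞` into those normalised at `-∞`. -/
theorem isModifiedJostPlus_iff_reflect {w : ℝ → ℂ} {l : ℂ} {j : Fin 2} {m : ℝ → Fin 2 → ℂ} :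
    IsModifiedJostPlus w l j m ↔ IsModifiedJostMinus (reflect w) l j.rev (reflectSol m) := by
  have key : ∀ (x : ℝ) (i : Fin 2),
      (∫ y in Set.Ioi (-x), exp (-(I * theta 0 (-x - y) l * sgn i.rev)) *
        (potentialMatrix (w y) *ᵥ m y) i.rev * exp (I * theta 0 (-x - y) l * sgn j)) =
      -∫ y in Set.Iic x, exp (-(I * theta 0 (x - y) l * sgn i)) *
        (potentialMatrix (reflect w y) *ᵥ reflectSol m y) i *
          exp (I * theta 0 (x - y) l * sgn j.rev) := by
    intro x i
    rw [← integral_comp_neg_Iic x (fun y => exp (-(I * theta 0 (-x - y) l * sgn i.rev)) *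
        (potentialMatrix (w y) *ᵥ m y) i.rev * exp (I * theta 0 (-x - y) l * sgn j)),
      ← integral_neg]
    congr 1
    funext y
    have h1 : theta 0 (-x - -y) l = -theta 0 (x - y) l := by
      simp only [theta]
      push_cast
      ring
    rw [potentialMatrix_reflect_mulVec, h1, sgn_rev, sgn_rev]
    simp only [mul_neg, neg_mul, neg_neg]
  constructor
  · rintro ⟨h1, ⟨K, hK⟩, h3⟩
    refine ⟨continuous_reflectSol h1, ⟨K, fun x => (norm_reflectSol_le m x).trans (hK _)⟩,
      fun x i => ?_⟩
    have := h3 (-x) i.rev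
    rw [key, sub_neg_eq_add] at this
    simpa [reflectSol, Fin.rev_eq_iff] using this
  · rintro ⟨h1, ⟨K, hK⟩, h3⟩
    have h1' := continuous_reflectSol h1
    rw [reflectSol_reflectSol] at h1'
    refine ⟨h1', ⟨K, fun x => ?_⟩, fun x i => ?_⟩
    · have := norm_reflectSol_le (reflectSol m) x
      rw [reflectSol_reflectSol] at this
      exact this.trans (hK _)
    · have h4 := h3 (-x) i.rev
      have h5 := key (-x) i.rev
      rw [neg_neg, Fin.rev_rev] at h5
      rw [h5, sub_neg_eq_add]
      simpa [reflectSol, Fin.rev_inj] using h4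

theorem IsModifiedSolution.reflect {w : ℝ → ℂ} {l : ℂ} {j : Fin 2} {m : ℝ → Fin 2 → ℂ}
    (hm : IsModifiedSolution w l j m) :
    IsModifiedSolution (reflect w) l j.rev (reflectSol m) := by
  intro x i
  have h1 := (hm (-x) i.rev).scomp x (hasDerivAt_neg x)
  refine h1.congr_deriv ?_
  rw [potentialMatrix_reflect_mulVec]
  have h2 := rate_rev l j i.rev
  rw [Fin.rev_rev] at h2
  rw [h2]
  simp only [reflectSol, neg_smul, one_smul]
  ring

theorem IsModifiedSolution.of_reflect {w : ℝ → ℂ} {l : ℂ} {j : Fin 2} {m : ℝ → Fin 2 → ℂ}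
    (hm : IsModifiedSolution (NLSScattering.reflect w) l j.rev (reflectSol m)) :
    IsModifiedSolution w l j m := by
  have := hm.reflect
  rwa [reflect_reflect, reflectSol_reflectSol, Fin.rev_rev] at this

theorem isModifiedJostPlus_modifiedJostPlus {w : ℝ → ℂ} (hw : Continuous w) (hi : Integrable w)
    {l : ℂ} {j : Fin 2} (hlj : Admissible l j.rev) :
    IsModifiedJostPlus w l j (modifiedJostPlus w l j) := by
  obtain ⟨m, hm⟩ := exists_isModifiedJostMinus (continuous_reflect hw) (integrable_reflect hi) hlj
  refine Classical.epsilon_spec (p := IsModifiedJostPlus w l j) ⟨reflectSol m, ?_⟩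
  rwa [isModifiedJostPlus_iff_reflect, reflectSol_reflectSol]

theorem IsModifiedJostPlus.unique {w : ℝ → ℂ} (hw : Continuous w) (hi : Integrable w) {l : ℂ}
    {j : Fin 2} (hlj : Admissible l j.rev) {m n : ℝ → Fin 2 → ℂ}
    (hm : IsModifiedJostPlus w l j m) (hn : IsModifiedJostPlus w l j n) : m = n := by
  have := IsModifiedJostMinus.unique (continuous_reflect hw) (integrable_reflect hi) hlj
    (isModifiedJostPlus_iff_reflect.1 hm) (isModifiedJostPlus_iff_reflect.1 hn)
  rw [← reflectSol_reflectSol m, this, reflectSol_reflectSol]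

theorem IsModifiedJostPlus.isModifiedSolution {w : ℝ → ℂ} (hw : Continuous w)
    (hi : Integrable w) {l : ℂ} {j : Fin 2} (hlj : Admissible l j.rev) {m : ℝ → Fin 2 → ℂ}
    (hm : IsModifiedJostPlus w l j m) : IsModifiedSolution w l j m :=
  ((isModifiedJostPlus_iff_reflect.1 hm).isModifiedSolution (continuous_reflect hw)
    (integrable_reflect hi) hlj).of_reflect

theorem IsModifiedJostPlus.tendsto_atTop {w : ℝ → ℂ} (hw : Continuous w)
    (hi : Integrable w) {l : ℂ} {j : Fin 2} (hlj : Admissible l j.rev) {m : ℝ → Fin 2 → ℂ}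
    (hm : IsModifiedJostPlus w l j m) (i : Fin 2) :
    Tendsto (fun x => m x i) atTop (𝓝 (if i = j then 1 else 0)) := by
  have := ((isModifiedJostPlus_iff_reflect.1 hm).tendsto_atBot (continuous_reflect hw)
    (integrable_reflect hi) hlj i.rev).comp tendsto_neg_atTop_atBot
  simpa [Function.comp_def, reflectSol, Fin.rev_inj] using this

theorem IsModifiedJostPlus.tendsto_atBot_zero {w : ℝ → ℂ} (hw : Continuous w)
    (hi : Integrable w) {l : ℂ} (hl : 0 < l.im) {m : ℝ → Fin 2 → ℂ}
    (hm : IsModifiedJostPlus w l 1 m) : Tendsto (fun x => m x 0) atBot (𝓝 0) := by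
  have := ((isModifiedJostPlus_iff_reflect.1 hm).tendsto_atTop_one (continuous_reflect hw)
    (integrable_reflect hi) hl).comp tendsto_neg_atBot_atTop
  simpa [Function.comp_def, reflectSol] using this

theorem IsModifiedSolution.isModifiedJostPlus {w : ℝ → ℂ} (hw : Continuous w)
    (hi : Integrable w) {l : ℂ} {j : Fin 2} (hlj : Admissible l j.rev) {m : ℝ → Fin 2 → ℂ}
    (hm : IsModifiedSolution w l j m) {K : ℝ} (hK : ∀ x, ‖m x‖ ≤ K)
    (hlim : ∀ i, Tendsto (fun x => m x i) atTop (𝓝 (if i = j then 1 else 0))) :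
    IsModifiedJostPlus w l j m := by
  refine isModifiedJostPlus_iff_reflect.2 (hm.reflect.isModifiedJostMinus (continuous_reflect hw)
    (integrable_reflect hi) hlj (fun x => (norm_reflectSol_le m x).trans (hK _)) fun i => ?_)
  have := (hlim i.rev).comp tendsto_neg_atBot_atTop
  simpa [Function.comp_def, reflectSol, Fin.rev_eq_iff] using this

/-! ### The Darboux matrix in Bloch coordinates -/

/-- The coordinates `p = P₁₂` and `q = P₂₂ - P₁₁` of the projector field `P` of a Darboux
transformation: the equations express that `P` projects onto a solution of the
Zakharov–Shabat system of `w` at `l₀`, and the limits that this solution is asymptotically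
proportional to `(0, 1)` at `-∞` and to `(1, 0)` at `+∞`. -/
structure IsDarbouxPair (w : ℝ → ℂ) (l₀ : ℂ) (p : ℝ → ℂ) (q : ℝ → ℝ) : Prop where
  hasDerivAt_p : ∀ x, HasDerivAt p
    (-(2 * I * l₀.re) * p x + w x * q x + 2 * l₀.im * q x * p x) x
  hasDerivAt_q : ∀ x, HasDerivAt q (-(8 * l₀.im * normSq (p x)) - 4 * (conj (w x) * p x).re) x
  sq_add : ∀ x, 4 * normSq (p x) + q x ^ 2 = 1
  tendsto_atBot : Tendsto q atBot (𝓝 1)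
  tendsto_atTop : Tendsto q atTop (𝓝 (-1))

/-- The Darboux matrix `D = (l - l₀*) 1 + (l₀* - l₀) P` in terms of `p = P₁₂` and
`q = P₂₂ - P₁₁`. -/
def darbouxFactor (l₀ l p : ℂ) (q : ℝ) : Matrix (Fin 2) (Fin 2) ℂ :=
  !![l - l₀.re + I * l₀.im * q, -(2 * I * l₀.im * p);
    -(2 * I * l₀.im * conj p), l - l₀.re - I * l₀.im * q]

theorem sub_conj_eq_re_im (l l₀ : ℂ) : l - conj l₀ = l - l₀.re + I * l₀.im := by
  apply Complex.ext <;> simp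

theorem sub_eq_re_im (l l₀ : ℂ) : l - l₀ = l - l₀.re - I * l₀.im := by
  apply Complex.ext <;> simp

theorem darbouxFactor_mulVec_zero (l₀ l p : ℂ) (q : ℝ) (v : Fin 2 → ℂ) :
    (darbouxFactor l₀ l p q *ᵥ v) 0 =
      (l - l₀.re + I * l₀.im * q) * v 0 - 2 * I * l₀.im * p * v 1 := by
  simp [darbouxFactor, Matrix.mulVec, dotProduct, Fin.sum_univ_two]
  ring

theorem darbouxFactor_mulVec_one (l₀ l p : ℂ) (q : ℝ) (v : Fin 2 → ℂ) :
    (darbouxFactor l₀ l p q *ᵥ v) 1 =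
      (l - l₀.re - I * l₀.im * q) * v 1 - 2 * I * l₀.im * conj p * v 0 := by
  simp [darbouxFactor, Matrix.mulVec, dotProduct, Fin.sum_univ_two]
  ring

theorem det_darbouxFactor (l₀ l p : ℂ) {q : ℝ} (h : 4 * normSq p + q ^ 2 = 1) :
    (darbouxFactor l₀ l p q).det = (l - l₀) * (l - conj l₀) := by
  have h' : 4 * (p * conj p) + (q : ℂ) ^ 2 = 1 := by
    rw [mul_conj]
    exact_mod_cast h
  rw [sub_conj_eq_re_im, sub_eq_re_im, darbouxFactor, Matrix.det_fin_two_of]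
  linear_combination (l₀.im : ℂ) ^ 2 * h' - (4 * p * conj p * l₀.im ^ 2 + l₀.im ^ 2 * q ^ 2
    - l₀.im ^ 2) * I_sq

namespace IsDarbouxPair

variable {w : ℝ → ℂ} {l₀ : ℂ} {p : ℝ → ℂ} {q : ℝ → ℝ}

theorem continuous_p (h : IsDarbouxPair w l₀ p q) : Continuous p :=
  continuous_iff_continuousAt.2 fun x => (h.hasDerivAt_p x).continuousAt

theorem continuous_q (h : IsDarbouxPair w l₀ p q) : Continuous q :=
  continuous_iff_continuousAt.2 fun x => (h.hasDerivAt_q x).continuousAt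

theorem abs_q_le (h : IsDarbouxPair w l₀ p q) (x : ℝ) : |q x| ≤ 1 := by
  rw [abs_le]
  have h1 := h.sq_add x
  have h2 := normSq_nonneg (p x)
  constructor <;> nlinarith

theorem norm_p_le (h : IsDarbouxPair w l₀ p q) (x : ℝ) : ‖p x‖ ≤ 1 := by
  have h1 := h.sq_add x
  rw [normSq_eq_norm_sq] at h1
  nlinarith [sq_nonneg (q x), norm_nonneg (p x)]

theorem tendsto_p (h : IsDarbouxPair w l₀ p q) {F : Filter ℝ} {s : ℝ}
    (hs : s ^ 2 = 1) (hq : Tendsto q F (𝓝 s)) : Tendsto p F (𝓝 0) := by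
  have h1 : Tendsto (fun x => (1 - q x ^ 2) / 4) F (𝓝 0) := by
    simpa [hs] using ((hq.pow 2).const_sub 1).div_const 4
  have h2 : Tendsto (fun x => Real.sqrt ((1 - q x ^ 2) / 4)) F (𝓝 0) := by
    have := (Real.continuous_sqrt.tendsto 0).comp h1
    rwa [Real.sqrt_zero] at this
  refine squeeze_zero_norm (fun x => le_of_eq ?_) h2
  have h3 := h.sq_add x
  rw [normSq_eq_norm_sq] at h3
  rw [show (1 - q x ^ 2) / 4 = ‖p x‖ ^ 2 by linarith, Real.sqrt_sq (norm_nonneg _)]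

/-- The intertwining relation of the Darboux transformation: `D` maps solutions for `w` to
solutions for `w + 4 Im(l₀) p`. -/
theorem isModifiedSolution (h : IsDarbouxPair w l₀ p q) {l : ℂ} {j : Fin 2}
    {m : ℝ → Fin 2 → ℂ} (hm : IsModifiedSolution w l j m) :
    IsModifiedSolution (fun x => w x + 4 * l₀.im * p x) l j
      (fun x => darbouxFactor l₀ l (p x) (q x) *ᵥ m x) := by
  intro x
  have hp := h.hasDerivAt_p x
  have hpc := hp.star
  have hq := (h.hasDerivAt_q x).ofReal_comp
  have hm0 := hm x 0
  have hm1 := hm x 1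
  rw [potentialMatrix_mulVec_zero] at hm0
  rw [potentialMatrix_mulVec_one] at hm1
  have hrate : rate l j 1 - rate l j 0 = 2 * I * l := by
    simp [rate, sgn]
    ring
  have hre : (((conj (w x) * p x).re : ℝ) : ℂ) =
      (conj (w x) * p x + w x * conj (p x)) / 2 := by
    rw [re_eq_add_conj]
    simp
  have hns : ((normSq (p x) : ℝ) : ℂ) = p x * conj (p x) := (mul_conj _).symm
  rw [ofReal_sub, ofReal_neg, ofReal_mul, ofReal_mul, ofReal_mul, hre, hns] at hq
  rw [Fin.forall_fin_two]
  constructor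
  · simp only [darbouxFactor_mulVec_zero, darbouxFactor_mulVec_one, potentialMatrix_mulVec_zero]
    have hd := (((hq.const_mul (I * (l₀.im : ℂ))).const_add (l - l₀.re)).mul hm0).sub
      ((hp.const_mul (2 * I * (l₀.im : ℂ))).mul hm1)
    refine hd.congr_deriv ?_
    push_cast
    linear_combination (-(2 * I * l₀.im * p x * m x 1)) * hrate +
      (-(4 * l₀.im * p x * m x 1 * (l - l₀.re))) * I_sq
  · simp only [darbouxFactor_mulVec_zero, darbouxFactor_mulVec_one, potentialMatrix_mulVec_one]
    have hd := (((hq.const_mul (I * (l₀.im : ℂ))).const_sub (l - l₀.re)).mul hm1).sub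
      ((hpc.const_mul (2 * I * (l₀.im : ℂ))).mul hm0)
    refine hd.congr_deriv ?_
    simp only [starRingEnd_apply, star_add, star_mul', star_neg, map_add, map_mul]
    simp only [← starRingEnd_apply, conj_ofReal, conj_I, map_ofNat]
    push_cast
    linear_combination ((2 * I * l₀.im * conj (p x) * m x 0)) * hrate +
      ((4 * l₀.im * conj (p x) * m x 0 * (l - l₀.re))) * I_sq

theorem exists_norm_mulVec_le (h : IsDarbouxPair w l₀ p q) (l : ℂ) {m : ℝ → Fin 2 → ℂ} {K : ℝ}
    (hK : ∀ x, ‖m x‖ ≤ K) :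
    ∃ K', ∀ x, ‖darbouxFactor l₀ l (p x) (q x) *ᵥ m x‖ ≤ K' := by
  have hK0 : 0 ≤ K := (norm_nonneg _).trans (hK 0)
  have hA : ∀ x, ‖I * (l₀.im : ℂ) * (q x : ℂ)‖ ≤ |l₀.im| * 1 := by
    intro x
    rw [norm_mul, norm_mul, norm_I, one_mul, norm_real, norm_real, Real.norm_eq_abs,
      Real.norm_eq_abs]
    exact mul_le_mul_of_nonneg_left (h.abs_q_le x) (abs_nonneg _)
  have hB : ∀ x, ‖2 * I * (l₀.im : ℂ) * p x‖ ≤ 2 * |l₀.im| * 1 := by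
    intro x
    rw [norm_mul, norm_mul, norm_mul, norm_I, norm_real, Real.norm_eq_abs]
    norm_num
    exact mul_le_of_le_one_right (by positivity) (h.norm_p_le x)
  have hB' : ∀ x, ‖2 * I * (l₀.im : ℂ) * conj (p x)‖ ≤ 2 * |l₀.im| * 1 := by
    intro x
    refine le_trans (le_of_eq ?_) (hB x)
    rw [norm_mul, norm_mul _ (p x), RCLike.norm_conj]
  have hm0 : ∀ x i, ‖m x i‖ ≤ K := fun x i => (norm_le_pi_norm (m x) i).trans (hK x)
  refine ⟨(‖l - l₀.re‖ + |l₀.im| * 1) * K + 2 * |l₀.im| * 1 * K, fun x => ?_⟩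
  refine (pi_norm_le_iff_of_nonneg (by positivity)).2 (Fin.forall_fin_two.2 ⟨?_, ?_⟩)
  · rw [darbouxFactor_mulVec_zero]
    refine (norm_sub_le _ _).trans ?_
    rw [norm_mul, norm_mul _ (m x 1)]
    gcongr
    · exact (norm_add_le _ _).trans (add_le_add le_rfl (hA x))
    · exact hm0 x 0
    · exact hB x
    · exact hm0 x 1
  · rw [darbouxFactor_mulVec_one]
    refine (norm_sub_le _ _).trans ?_
    rw [norm_mul, norm_mul _ (m x 0)]
    gcongr
    · exact (norm_sub_le _ _).trans (add_le_add le_rfl (hA x))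
    · exact hm0 x 1
    · exact hB' x
    · exact hm0 x 0

/-- At an end where `q → s = ±1`, the off-diagonal entry `p` vanishes and `D` becomes the diagonal
matrix with entries `l - Re l₀ ± i s Im l₀`. -/
theorem tendsto_mulVec (h : IsDarbouxPair w l₀ p q) (l : ℂ) {m : ℝ → Fin 2 → ℂ} {F : Filter ℝ}
    {s : ℝ} (hs : s ^ 2 = 1) (hq : Tendsto q F (𝓝 s)) {j : Fin 2}
    (hm : ∀ i, Tendsto (fun x => m x i) F (𝓝 (if i = j then 1 else 0))) (i : Fin 2) :
    Tendsto (fun x => (darbouxFactor l₀ l (p x) (q x) *ᵥ m x) i) F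
      (𝓝 (if i = j then l - l₀.re + sgn j * s * I * l₀.im else 0)) := by
  have hp := h.tendsto_p hs hq
  have hpc : Tendsto (fun x => conj (p x)) F (𝓝 0) := by
    simpa [Function.comp_def] using (continuous_conj.tendsto 0).comp hp
  have hqc : Tendsto (fun x => (q x : ℂ)) F (𝓝 s) := (continuous_ofReal.tendsto s).comp hq
  have h0 := ((((hqc.const_mul (I * (l₀.im : ℂ))).const_add (l - l₀.re)).mul (hm 0)).sub
      ((hp.const_mul (2 * I * (l₀.im : ℂ))).mul (hm 1)))
  have h1 := ((((hqc.const_mul (I * (l₀.im : ℂ))).const_sub (l - l₀.re)).mul (hm 1)).sub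
      ((hpc.const_mul (2 * I * (l₀.im : ℂ))).mul (hm 0)))
  fin_cases i
  · simp only [Fin.zero_eta, darbouxFactor_mulVec_zero]
    convert! h0 using 2
    fin_cases j
    · simp [sgn]
      ring
    · simp
  · simp only [Fin.mk_one, darbouxFactor_mulVec_one]
    convert! h1 using 2
    fin_cases j
    · simp
    · simp [sgn]
      ring

end IsDarbouxPair

/-! ### Projectors onto solutions of the Zakharov–Shabat system -/

/-- The off-diagonal entry `P₁₂` of the projector onto the line spanned by `v`. -/
noncomputable def projOff (v : Fin 2 → ℂ) : ℂ := v 0 * conj (v 1) / ((normSq (v 0) + normSq (v 1) : ℝ) : ℂ)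

/-- The difference `P₂₂ - P₁₁` of the diagonal entries of the projector onto the line spanned
by `v`. -/
noncomputable def projDiff (v : Fin 2 → ℂ) : ℝ :=
  (normSq (v 1) - normSq (v 0)) / (normSq (v 0) + normSq (v 1))

theorem normSq_add_pos {v : Fin 2 → ℂ} (hv : v ≠ 0) : 0 < normSq (v 0) + normSq (v 1) := by
  by_contra h
  have h0 := normSq_nonneg (v 0)
  have h1 := normSq_nonneg (v 1)
  apply hv
  funext i
  fin_cases i
  · exact normSq_eq_zero.1 (show normSq (v 0) = 0 by linarith)
  · exact normSq_eq_zero.1 (show normSq (v 1) = 0 by linarith)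

theorem projDiff_smul {c : ℂ} (hc : c ≠ 0) (v : Fin 2 → ℂ) : projDiff (c • v) = projDiff v := by
  simp only [projDiff, Pi.smul_apply, smul_eq_mul, map_mul, ← mul_add, ← mul_sub]
  exact mul_div_mul_left _ _ (normSq_pos.2 hc).ne'

theorem four_mul_normSq_projOff_add {v : Fin 2 → ℂ} (hv : v ≠ 0) :
    4 * normSq (projOff v) + projDiff v ^ 2 = 1 := by
  have h := (normSq_add_pos hv).ne'
  simp only [projOff, projDiff, map_div₀, map_mul, normSq_conj, normSq_ofReal]
  field_simp
  ring

theorem tendsto_projDiff {F : Filter ℝ} {v : ℝ → Fin 2 → ℂ} {z : Fin 2 → ℂ} (hz : z ≠ 0)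
    (h : ∀ i, Tendsto (fun x => v x i) F (𝓝 (z i))) :
    Tendsto (fun x => projDiff (v x)) F (𝓝 (projDiff z)) := by
  have h0 := (continuous_normSq.tendsto _).comp (h 0)
  have h1 := (continuous_normSq.tendsto _).comp (h 1)
  exact (h1.sub h0).div (h0.add h1) (normSq_add_pos hz).ne'

theorem projector_zero_one (v : Fin 2 → ℂ) : projector v 0 1 = projOff v := by
  simp only [projector, projOff, Matrix.smul_apply, Matrix.vecMulVec_apply, dotProduct,
    Fin.sum_univ_two, Pi.star_apply, smul_eq_mul, RCLike.star_def, ofReal_add, ← mul_conj]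
  rw [div_eq_inv_mul, mul_comm (conj (v 0)), mul_comm (conj (v 1))]

theorem darbouxPotential_eq (u : ℝ → ℝ → ℂ) (l₀ u₀ v₀ : ℂ) (t x : ℝ) :
    darbouxPotential u l₀ u₀ v₀ t x =
      u t x + 4 * l₀.im * projOff (seedSolution u l₀ u₀ v₀ t x) := by
  have h : I * (l₀ - conj l₀) = -(2 * l₀.im) := by
    apply Complex.ext <;> simp
    ring
  rw [darbouxPotential, darbouxMatrix, h, ← projector_zero_one]
  generalize projector (seedSolution u l₀ u₀ v₀ t x) = P
  simp [potentialMatrix, sigma3, sgn, Matrix.mul_diagonal, Matrix.diagonal_mul]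
  ring

/-- `s` solves the Zakharov–Shabat system `s' = (-i l σ₃ + Q) s`. -/
def IsSolution (w : ℝ → ℂ) (l : ℂ) (s : ℝ → Fin 2 → ℂ) : Prop :=
  ∀ x i, HasDerivAt (fun y => s y i)
    (-(I * l * sgn i) * s x i + (potentialMatrix (w x) *ᵥ s x) i) x

theorem IsModifiedSolution.isSolution {w : ℝ → ℂ} {l : ℂ} {j : Fin 2} {m : ℝ → Fin 2 → ℂ}
    (hm : IsModifiedSolution w l j m) (t : ℝ) :
    IsSolution w l (fun x => exp (-(I * theta t x l * sgn j)) • m x) := by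
  intro x i
  have h1 : HasDerivAt (fun x : ℝ => -(I * theta t x l * sgn j)) (-(I * l * sgn j)) x := by
    unfold theta
    have := (((((hasDerivAt_id x).ofReal_comp.const_mul l).add_const (2 * l ^ 2 * (t : ℂ))).const_mul
      I).mul_const (sgn j)).neg
    refine this.congr_deriv ?_
    simp
  have h2 := h1.cexp.mul (hm x i)
  simp only [Pi.smul_apply, smul_eq_mul, Matrix.mulVec_smul]
  refine h2.congr_deriv ?_
  simp only [rate]
  ring

theorem IsSolution.smul_add_smul {w : ℝ → ℂ} {l : ℂ} {r s : ℝ → Fin 2 → ℂ}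
    (hr : IsSolution w l r) (hs : IsSolution w l s) (c d : ℂ) :
    IsSolution w l (fun x => c • r x + d • s x) := by
  intro x i
  have := ((hr x i).const_mul c).add ((hs x i).const_mul d)
  simp only [Pi.add_apply, Pi.smul_apply, smul_eq_mul, Matrix.mulVec_smul, Matrix.mulVec_add]
  refine this.congr_deriv ?_
  ring

/-- The coordinates of the projector onto a solution obey the closed system of
`IsDarbouxPair`. -/
theorem IsSolution.isDarbouxPair {w : ℝ → ℂ} {l₀ : ℂ} {s : ℝ → Fin 2 → ℂ}
    (hs : IsSolution w l₀ s) (hne : ∀ x, s x ≠ 0)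
    (hbot : Tendsto (fun x => projDiff (s x)) atBot (𝓝 1))
    (htop : Tendsto (fun x => projDiff (s x)) atTop (𝓝 (-1))) :
    IsDarbouxPair w l₀ (fun x => projOff (s x)) (fun x => projDiff (s x)) := by
  have hsum : l₀ + conj l₀ = 2 * l₀.re := by
    apply Complex.ext <;> simp
    ring
  have hdiff : I * (l₀ - conj l₀) = -(2 * l₀.im) := by
    apply Complex.ext <;> simp
    ring
  refine ⟨fun x => ?_, fun x => ?_, fun x => four_mul_normSq_projOff_add (hne x), hbot, htop⟩
  all_goals
    have ha := hs x 0
    have hb := hs x 1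
    rw [potentialMatrix_mulVec_zero] at ha
    rw [potentialMatrix_mulVec_one] at hb
    have hac := ha.star
    have hbc := hb.star
    simp only [starRingEnd_apply, star_add, star_mul', star_neg, sgn] at hac hbc
    simp only [← starRingEnd_apply, conj_I] at hac hbc
    simp only [sgn, Matrix.cons_val_zero, Matrix.cons_val_one, mul_one, mul_neg, neg_neg, map_neg,
      map_one, neg_mul, conj_conj] at ha hb hac hbc
    have hN : s x 0 * conj (s x 0) + s x 1 * conj (s x 1) ≠ 0 := by
      rw [mul_conj, mul_conj, ← ofReal_add]
      exact ofReal_ne_zero.2 (normSq_add_pos (hne x)).ne'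
    have hNd := (ha.mul hac).add (hb.mul hbc)
    have hqc : ((projDiff (s x) : ℝ) : ℂ) = (s x 1 * conj (s x 1) - s x 0 * conj (s x 0)) /
        (s x 0 * conj (s x 0) + s x 1 * conj (s x 1)) := by
      simp only [projDiff, ofReal_div, ofReal_sub, ofReal_add, mul_conj]
    have hpc : projOff (s x) = s x 0 * conj (s x 1) /
        (s x 0 * conj (s x 0) + s x 1 * conj (s x 1)) := by
      simp only [projOff, ofReal_add, mul_conj]
  · have hd := (ha.mul hbc).div hNd hN
    have hfun : (fun x => projOff (s x)) = fun x => s x 0 * conj (s x 1) /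
        (s x 0 * conj (s x 0) + s x 1 * conj (s x 1)) := by
      funext x
      simp only [projOff, ofReal_add, mul_conj]
    rw [hfun]
    refine HasDerivAt.congr_deriv hd ?_
    simp only [hpc, hqc, Pi.mul_apply, Pi.add_apply]
    simp only [starRingEnd_apply] at hN hsum hdiff ⊢
    field_simp
    linear_combination (-I * (s x 0 * star (s x 1)) *
      (s x 0 * star (s x 0) + s x 1 * star (s x 1))) * hsum +
      (s x 0 * star (s x 1)) * (s x 0 * star (s x 0) - s x 1 * star (s x 1)) * hdiff
  · have hd := ((hb.mul hbc).sub (ha.mul hac)).div hNd hN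
    have hfun : (fun x => ((projDiff (s x) : ℝ) : ℂ)) = fun x =>
        (s x 1 * conj (s x 1) - s x 0 * conj (s x 0)) /
        (s x 0 * conj (s x 0) + s x 1 * conj (s x 1)) := by
      funext x
      simp only [projDiff, ofReal_div, ofReal_sub, ofReal_add, mul_conj]
    have hval : ((-(8 * l₀.im * normSq (projOff (s x))) - 4 * (conj (w x) * projOff (s x)).re : ℝ)
        : ℂ) = -(8 * l₀.im * (projOff (s x) * conj (projOff (s x)))) -
          4 * ((conj (w x) * projOff (s x) + w x * conj (projOff (s x))) / 2) := by
      rw [mul_conj, ← conj_conj (w x), ← map_mul, conj_conj, ← re_eq_add_conj]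
      push_cast
      ring
    have hdc : HasDerivAt (fun x => ((projDiff (s x) : ℝ) : ℂ)) ((-(8 * l₀.im *
        normSq (projOff (s x))) - 4 * (conj (w x) * projOff (s x)).re : ℝ) : ℂ) x := by
      rw [hfun, hval]
      refine HasDerivAt.congr_deriv hd ?_
      simp only [hpc, Pi.mul_apply, Pi.add_apply, Pi.sub_apply, map_div₀, map_mul, map_add,
        conj_conj]
      simp only [starRingEnd_apply] at hN hdiff ⊢
      have hN' : star (s x 0) * s x 0 + star (s x 1) * s x 1 ≠ 0 := by
        rwa [mul_comm (star (s x 0)), mul_comm (star (s x 1))]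
      rw [mul_comm (star (s x 0)) (s x 0), mul_comm (star (s x 1)) (s x 1)]
      field_simp
      linear_combination 8 * (s x 0 * star (s x 0)) * (s x 1 * star (s x 1)) * hdiff
    simpa [Function.comp_def] using reCLM.hasFDerivAt.comp_hasDerivAt x hdc

/-! ### The transformed potential lies in `H^{1,1}(ℝ)` -/

/-- If `f ≤ g - Φ'` with `g` integrable and `Φ ≥ 0`, then `∫_R^X f ≤ ∫ g + Φ(R)` for all `X`. -/
theorem integrableOn_Ioi_of_le_sub_deriv {f g Φ Φ' : ℝ → ℝ} {R : ℝ} (hf : Continuous f)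
    (hf0 : ∀ x, 0 ≤ f x) (hΦ : ∀ x, HasDerivAt Φ (Φ' x) x) (hΦ' : Continuous Φ')
    (hΦ0 : ∀ x, R ≤ x → 0 ≤ Φ x) (hg : Integrable g) (hg0 : ∀ x, 0 ≤ g x)
    (h : ∀ x, R ≤ x → f x ≤ g x - Φ' x) : IntegrableOn f (Set.Ioi R) := by
  refine integrableOn_Ioi_of_intervalIntegral_norm_bounded ((∫ x, g x) + Φ R) R
    (b := id) (l := atTop) (fun x => (hf.integrableOn_Icc).mono_set Set.Ioc_subset_Icc_self)
    tendsto_id ?_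
  filter_upwards [eventually_ge_atTop R] with X hX
  simp only [id, Real.norm_of_nonneg (hf0 _)]
  calc ∫ x in R..X, f x ≤ ∫ x in R..X, (g x - Φ' x) :=
        intervalIntegral.integral_mono_on hX (hf.intervalIntegrable _ _)
          (hg.intervalIntegrable.sub (hΦ'.intervalIntegrable _ _)) fun x hx => h x hx.1
    _ = (∫ x in R..X, g x) - (Φ X - Φ R) := by
        rw [intervalIntegral.integral_sub hg.intervalIntegrable (hΦ'.intervalIntegrable _ _),
          intervalIntegral.integral_eq_sub_of_hasDerivAt (fun x _ => hΦ x)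
            (hΦ'.intervalIntegrable _ _)]
    _ ≤ (∫ x, g x) + Φ R := by
        have h1 : ∫ x in R..X, g x ≤ ∫ x, g x := by
          rw [intervalIntegral.integral_of_le hX]
          exact setIntegral_le_integral hg (Eventually.of_forall hg0)
        linarith [hΦ0 X hX]

theorem abs_four_mul_re_le (z p : ℂ) {η c : ℝ} (hη : 0 < η) (hc : η * c = 1) :
    -(4 * (conj z * p).re) ≤ 4 * η * normSq p + c * ‖z‖ ^ 2 := by
  have h1 : |(conj z * p).re| ≤ ‖z‖ * ‖p‖ := by
    refine (abs_re_le_norm _).trans (le_of_eq ?_)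
    rw [norm_mul, RCLike.norm_conj]
  have h2 := (abs_le.1 h1).1
  have hc0 : 0 < c := by
    by_contra h
    nlinarith
  rw [normSq_eq_norm_sq]
  have h3 : 0 ≤ c * (2 * η * ‖p‖ - ‖z‖) ^ 2 := by positivity
  have h4 : c * (2 * η * ‖p‖ - ‖z‖) ^ 2 =
      4 * η * (η * c) * ‖p‖ ^ 2 - 4 * (η * c) * ‖p‖ * ‖z‖ + c * ‖z‖ ^ 2 := by ring
  rw [hc] at h4
  nlinarith

section HalfLine

variable {w p : ℝ → ℂ} {q : ℝ → ℝ} {η : ℝ}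

/-- The equation of `q` bounds `8 η |p|²` by `-q'` up to a term controlled by `|w|²`. -/
theorem integrableOn_normSq_of_bloch (hη : 0 < η) (hw : Continuous w) (hp : Continuous p)
    (hw2 : Integrable fun x => ‖w x‖ ^ 2)
    (hq : ∀ x, HasDerivAt q (-(8 * η * normSq (p x)) - 4 * (conj (w x) * p x).re) x)
    (hsq : ∀ x, 4 * normSq (p x) + q x ^ 2 = 1) :
    IntegrableOn (fun x => normSq (p x)) (Set.Ioi 0) := by
  have hcw : Continuous fun x => conj (w x) := continuous_conj.comp hw
  have hnp : Continuous fun x => normSq (p x) := continuous_normSq.comp hp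
  have hηc : η * η⁻¹ = 1 := mul_inv_cancel₀ hη.ne'
  have h := integrableOn_Ioi_of_le_sub_deriv (f := fun x => 4 * η * normSq (p x))
    (g := fun x => η⁻¹ * ‖w x‖ ^ 2) (Φ := fun x => q x + 1)
    (Φ' := fun x => -(8 * η * normSq (p x)) - 4 * (conj (w x) * p x).re) (R := 0)
    (by fun_prop) (fun x => mul_nonneg (by positivity) (normSq_nonneg _))
    (fun x => (hq x).add_const 1)
    (by fun_prop)
    (fun x _ => by nlinarith [hsq x, normSq_nonneg (p x)]) (hw2.const_mul _)
    (fun x => by positivity) (fun x _ => by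
      have := abs_four_mul_re_le (w x) (p x) hη hηc
      linarith)
  refine (h.const_mul (4 * η)⁻¹).congr (Eventually.of_forall fun x => ?_)
  field_simp

/-- The same with the weight `x²`: where `q ≤ 0`, the boundary term `q + 1` is at most `4 |p|²`. -/
theorem integrableOn_weighted_normSq_of_bloch (hη : 0 < η) (hw : Continuous w) (hp : Continuous p)
    (hxw2 : Integrable fun x => x ^ 2 * ‖w x‖ ^ 2)
    (hq : ∀ x, HasDerivAt q (-(8 * η * normSq (p x)) - 4 * (conj (w x) * p x).re) x)
    (hsq : ∀ x, 4 * normSq (p x) + q x ^ 2 = 1) (hneg : ∀ᶠ x in atTop, q x ≤ 0)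
    (hp2 : Integrable fun x => normSq (p x)) :
    IntegrableOn (fun x => x ^ 2 * normSq (p x)) (Set.Ioi 0) := by
  have hcw : Continuous fun x => conj (w x) := continuous_conj.comp hw
  have hnp : Continuous fun x => normSq (p x) := continuous_normSq.comp hp
  have hqc : Continuous q := continuous_iff_continuousAt.2 fun x => (hq x).continuousAt
  have hηc : η * η⁻¹ = 1 := mul_inv_cancel₀ hη.ne'
  obtain ⟨R, hR0, hR⟩ : ∃ R, 0 ≤ R ∧ ∀ x, R ≤ x → q x ≤ 0 := by
    obtain ⟨R, hR⟩ := eventually_atTop.1 hneg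
    exact ⟨max R 0, le_max_right _ _, fun x hx => hR x ((le_max_left _ _).trans hx)⟩
  have h := integrableOn_Ioi_of_le_sub_deriv (f := fun x => 2 * η * (x ^ 2 * normSq (p x)))
    (g := fun x => 8 * η⁻¹ * normSq (p x) + η⁻¹ * (x ^ 2 * ‖w x‖ ^ 2))
    (Φ := fun x => x ^ 2 * (q x + 1))
    (Φ' := fun x => 2 * x * (q x + 1) +
      x ^ 2 * (-(8 * η * normSq (p x)) - 4 * (conj (w x) * p x).re)) (R := R)
    (by fun_prop)
    (fun x => mul_nonneg (by positivity) (mul_nonneg (by positivity) (normSq_nonneg _)))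
    (fun x => by
      refine ((hasDerivAt_pow 2 x).mul ((hq x).add_const 1)).congr_deriv ?_
      simp)
    (by fun_prop)
    (fun x _ => mul_nonneg (by positivity) (by nlinarith [hsq x, normSq_nonneg (p x)]))
    ((hp2.const_mul _).add (hxw2.const_mul _))
    (fun x => add_nonneg (mul_nonneg (by positivity) (normSq_nonneg _)) (by positivity))
    (fun x hx => by
      have hx0 : 0 ≤ x := hR0.trans hx
      have hqx := hR x hx
      have hs := hsq x
      have hn := normSq_nonneg (p x)
      have h1 : q x + 1 ≤ 4 * normSq (p x) := by nlinarith
      have h2 := mul_le_mul_of_nonneg_left (abs_four_mul_re_le (w x) (p x) hη hηc) (sq_nonneg x)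
      have h3 : 2 * x * (q x + 1) ≤ 8 * x * normSq (p x) := by nlinarith
      -- Young's inequality absorbs `8 x |p|²` into `2 η x² |p|²` and `8 η⁻¹ |p|²`
      have h4 : 0 ≤ 2 * η⁻¹ * (η * x - 2) ^ 2 * normSq (p x) := mul_nonneg (by positivity) hn
      have h5 : 2 * η⁻¹ * (η * x - 2) ^ 2 * normSq (p x) =
          2 * η * (η * η⁻¹) * x ^ 2 * normSq (p x) - 8 * (η * η⁻¹) * x * normSq (p x) +
            8 * η⁻¹ * normSq (p x) := by ring
      rw [hηc] at h5
      nlinarith)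
  have h' : IntegrableOn (fun x => x ^ 2 * normSq (p x)) (Set.Ioi R) := by
    refine (h.const_mul (2 * η)⁻¹).congr (Eventually.of_forall fun x => ?_)
    field_simp
  have hc : IntegrableOn (fun x => x ^ 2 * normSq (p x)) (Set.Ioc 0 R) :=
    (Continuous.integrableOn_Icc (by fun_prop)).mono_set Set.Ioc_subset_Icc_self
  rw [← Set.Ioc_union_Ioi_eq_Ioi hR0]
  exact hc.union h'

end HalfLine

theorem integrable_of_integrableOn_Ioi_comp_neg {f : ℝ → ℝ} (h : IntegrableOn f (Set.Ioi 0))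
    (h' : IntegrableOn (fun x => f (-x)) (Set.Ioi 0)) : Integrable f := by
  have h1 : IntegrableOn f (Set.Iio 0) := by
    have := h'.comp_neg
    simpa using this
  have h2 : IntegrableOn f (Set.Iic 0) := (integrableOn_Iic_iff_integrableOn_Iio (by simp)).2 h1
  rw [← integrableOn_univ, ← Set.Iic_union_Ioi (a := (0 : ℝ))]
  exact h2.union h

namespace IsDarbouxPair

variable {w : ℝ → ℂ} {l₀ : ℂ} {p : ℝ → ℂ} {q : ℝ → ℝ}

theorem hasDerivAt_neg_q_comp_neg (h : IsDarbouxPair w l₀ p q) (x : ℝ) :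
    HasDerivAt (fun x => -q (-x)) (-(8 * l₀.im * normSq (p (-x))) -
      4 * (conj (w (-x)) * p (-x)).re) x := by
  refine ((h.hasDerivAt_q (-x)).scomp x (hasDerivAt_neg x)).neg.congr_deriv ?_
  simp only [smul_eq_mul, neg_mul, one_mul, neg_neg]

theorem integrable_normSq (h : IsDarbouxPair w l₀ p q) (hη : 0 < l₀.im) (hw : MemH11 w) :
    Integrable fun x => normSq (p x) := by
  refine integrable_of_integrableOn_Ioi_comp_neg (integrableOn_normSq_of_bloch hη hw.continuous
    h.continuous_p hw.integrable_sq h.hasDerivAt_q h.sq_add) ?_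
  exact integrableOn_normSq_of_bloch (w := fun x => w (-x)) (p := fun x => p (-x))
    (q := fun x => -q (-x)) hη (hw.continuous.comp continuous_neg)
    (h.continuous_p.comp continuous_neg) hw.integrable_sq.comp_neg h.hasDerivAt_neg_q_comp_neg
    fun x => by simpa using h.sq_add (-x)

theorem integrable_weighted_normSq (h : IsDarbouxPair w l₀ p q) (hη : 0 < l₀.im)
    (hw : MemH11 w) : Integrable fun x => x ^ 2 * normSq (p x) := by
  have hp2 := h.integrable_normSq hη hw
  refine integrable_of_integrableOn_Ioi_comp_neg (integrableOn_weighted_normSq_of_bloch hη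
    hw.continuous h.continuous_p hw.integrable_weighted_sq h.hasDerivAt_q
    h.sq_add (h.tendsto_atTop.eventually_le_const (by norm_num)) hp2) ?_
  have hneg : ∀ᶠ x in atTop, -q (-x) ≤ 0 := by
    have h1 := (h.tendsto_atBot.comp tendsto_neg_atTop_atBot).eventually_const_le
      (show (0 : ℝ) < 1 by norm_num)
    filter_upwards [h1] with x hx
    simpa using hx
  have := integrableOn_weighted_normSq_of_bloch (w := fun x => w (-x)) (p := fun x => p (-x))
    (q := fun x => -q (-x)) hη (hw.continuous.comp continuous_neg)
    (h.continuous_p.comp continuous_neg)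
    (by simpa using hw.integrable_weighted_sq.comp_neg) h.hasDerivAt_neg_q_comp_neg
    (fun x => by simpa using h.sq_add (-x)) hneg hp2.comp_neg
  simpa using this

theorem memH11 (h : IsDarbouxPair w l₀ p q) (hη : 0 < l₀.im) (hw : MemH11 w) :
    MemH11 fun x => w x + 4 * l₀.im * p x := by
  have hpm : AEStronglyMeasurable p := h.continuous_p.aestronglyMeasurable
  have hp2 : MemLp p 2 volume := (memLp_two_iff_integrable_sq_norm hpm).2 (by
    simpa only [normSq_eq_norm_sq] using h.integrable_normSq hη hw)
  have hxp : MemLp (fun x : ℝ => (x : ℂ) * p x) 2 volume := by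
    refine (memLp_two_iff_integrable_sq_norm (continuous_ofReal.mul
      h.continuous_p).aestronglyMeasurable).2 ?_
    refine (h.integrable_weighted_normSq hη hw).congr (Eventually.of_forall fun x => ?_)
    simp [normSq_eq_norm_sq, mul_pow]
  have hqc := h.continuous_q
  have hpc := h.continuous_p
  have hwc := hw.continuous
  have hqle : ∀ x (z : ℂ), ‖(q x : ℂ) * z‖ ≤ ‖z‖ := by
    intro x z
    rw [norm_mul, norm_real, Real.norm_eq_abs]
    exact mul_le_of_le_one_left (norm_nonneg _) (h.abs_q_le x)
  have hqw : MemLp (fun x => (q x : ℂ) * w x) 2 volume :=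
    hw.1.of_le (Continuous.aestronglyMeasurable (by fun_prop))
      (Eventually.of_forall fun x => hqle x _)
  have hqp : MemLp (fun x => (q x : ℂ) * p x) 2 volume :=
    hp2.of_le (Continuous.aestronglyMeasurable (by fun_prop))
      (Eventually.of_forall fun x => hqle x _)
  have hp' : MemLp (fun x => -(2 * I * l₀.re) * p x + w x * q x + 2 * l₀.im * q x * p x) 2
      volume := by
    refine (((hp2.const_mul (-(2 * I * l₀.re))).add hqw).add
      (hqp.const_mul (2 * (l₀.im : ℂ)))).ae_eq (Eventually.of_forall fun x => ?_)
    simp only [Pi.add_apply]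
    ring
  obtain ⟨hw1, hw2, g, hg, hgw⟩ := hw
  refine ⟨hw1.add (hp2.const_mul _), ?_, fun x => g x + 4 * l₀.im *
    (-(2 * I * l₀.re) * p x + w x * q x + 2 * l₀.im * q x * p x),
    hg.add (hp'.const_mul _), fun x => ?_⟩
  · refine (hw2.add (hxp.const_mul (4 * (l₀.im : ℂ)))).ae_eq (Eventually.of_forall fun x => ?_)
    simp only [Pi.add_apply]
    ring
  · have hcont : Continuous fun x : ℝ =>
        -(2 * I * l₀.re) * p x + w x * q x + 2 * l₀.im * q x * p x := by fun_prop
    have hli : LocallyIntegrable g volume := hg.locallyIntegrable (by norm_num)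
    have hgi : IntervalIntegrable g volume 0 x :=
      (hli.integrableOn_isCompact isCompact_uIcc).intervalIntegrable
    have hFTC := intervalIntegral.integral_eq_sub_of_hasDerivAt (a := 0) (b := x)
      (fun y _ => h.hasDerivAt_p y) (hcont.intervalIntegrable _ _)
    rw [intervalIntegral.integral_add hgi ((hcont.intervalIntegrable _ _).const_mul _),
      intervalIntegral.integral_const_mul, hFTC]
    simp only [hgw x]
    ring

end IsDarbouxPair

/-! ### Continuity of the Jost columns in the spectral parameter -/

theorem norm_exp_mul_sub_exp_mul_le {c c' : ℂ} {δ : ℝ} (hδ : 0 < δ) (hc : c.re ≤ -δ)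
    (hc' : c'.re ≤ -δ) {r : ℝ} (hr : 0 ≤ r) :
    ‖exp (c * (r : ℂ)) - exp (c' * (r : ℂ))‖ ≤ δ⁻¹ * ‖c - c'‖ := by
  refine (convex_halfSpace_re_le (-δ)).norm_image_sub_le_of_norm_hasDerivWithin_le
    (f := fun z : ℂ => exp (z * (r : ℂ))) (f' := fun z : ℂ => exp (z * (r : ℂ)) * r)
    (fun z _ => ?_) (fun z hz => ?_) hc' hc
  · have := ((hasDerivAt_id z).mul_const (r : ℂ)).cexp
    simpa using this.hasDerivWithinAt
  · have hz' : z.re ≤ -δ := hz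
    rw [norm_mul, norm_exp, norm_real, Real.norm_of_nonneg hr]
    have h1 : Real.exp (z * (r : ℂ)).re ≤ Real.exp (-(δ * r)) := by
      rw [Real.exp_le_exp]
      simp
      nlinarith
    have h2 : δ * r ≤ Real.exp (δ * r) := by linarith [Real.add_one_le_exp (δ * r)]
    calc Real.exp (z * (r : ℂ)).re * r ≤ Real.exp (-(δ * r)) * r := by gcongr
      _ = δ⁻¹ * (Real.exp (-(δ * r)) * (δ * r)) := by field_simp
      _ ≤ δ⁻¹ * (Real.exp (-(δ * r)) * Real.exp (δ * r)) := by gcongr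
      _ = δ⁻¹ * 1 := by
          rw [← Real.exp_add]
          simp
      _ = δ⁻¹ := mul_one _

theorem norm_duhamel_sub_le {c c' : ℂ} {ε : ℝ} (hc : c.re ≤ 0) (hc' : c'.re ≤ 0)
    (h : ∀ r : ℝ, 0 ≤ r → ‖exp (c * (r : ℂ)) - exp (c' * (r : ℂ))‖ ≤ ε) (hε : 0 ≤ ε)
    {F : ℝ → ℂ} (hF : Continuous F) (hi : Integrable F) (x : ℝ) :
    ‖duhamel c F x - duhamel c' F x‖ ≤ ε * ∫ y, ‖F y‖ := by
  unfold duhamel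
  rw [← integral_sub (integrableOn_duhamel hc hF hi x) (integrableOn_duhamel hc' hF hi x)]
  have h1 : ‖∫ y in Set.Iic x, (exp (c * ((x - y : ℝ) : ℂ)) * F y -
      exp (c' * ((x - y : ℝ) : ℂ)) * F y)‖ ≤ ∫ y in Set.Iic x, ε * ‖F y‖ := by
    refine norm_integral_le_of_norm_le (hi.norm.const_mul ε).integrableOn ?_
    refine (ae_restrict_iff' measurableSet_Iic).2 (Eventually.of_forall fun y hy => ?_)
    rw [← sub_mul, norm_mul]
    exact mul_le_mul_of_nonneg_right (h _ (sub_nonneg.2 hy)) (norm_nonneg _)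
  refine h1.trans ?_
  rw [integral_const_mul]
  exact mul_le_mul_of_nonneg_left (setIntegral_le_integral hi.norm
    (Eventually.of_forall fun _ => norm_nonneg _)) hε

theorem continuousAt_modifiedJostMinus {w : ℝ → ℂ} (hw : Continuous w) (hi : Integrable w)
    {l₀ : ℂ} (hl₀ : 0 < l₀.im) (x : ℝ) :
    ContinuousAt (fun l => modifiedJostMinus w l 0 x) l₀ := by
  obtain ⟨hc₀, ⟨K, hK⟩, hv₀⟩ := isModifiedJostMinus_iff.1
    (isModifiedJostMinus_modifiedJostMinus hw hi (admissible_zero hl₀.le))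
  set m₀ := modifiedJostMinus w l₀ 0
  have hK0 : 0 ≤ K := (norm_nonneg _).trans (hK 0)
  have hG : ∀ i, Continuous fun y => (potentialMatrix (w y) *ᵥ m₀ y) i :=
    continuous_potentialMatrix_mulVec hw hc₀
  have hGi : ∀ i, Integrable fun y => (potentialMatrix (w y) *ᵥ m₀ y) i :=
    integrable_potentialMatrix_mulVec hw hi hc₀ hK
  have hev : ∀ᶠ l in 𝓝 l₀, l₀.im / 2 < l.im :=
    continuous_im.continuousAt.eventually_const_lt (by linarith)
  rw [ContinuousAt, tendsto_iff_norm_sub_tendsto_zero]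
  -- the constant in Gronwall's inequality, which tends to `0` as `l → l₀`
  set F : ℂ → ℝ := fun l => l₀.im⁻¹ * (2 * ‖l - l₀‖) * ((∫ y, ‖w y‖) * K) with hFdef
  have hF0 : ∀ l, 0 ≤ F l := fun l => by
    have : 0 ≤ ∫ y, ‖w y‖ := integral_nonneg fun _ => norm_nonneg _
    positivity
  have hFlim : Tendsto (fun l => 2 * F l * Real.exp (2 * mass w x)) (𝓝 l₀) (𝓝 0) := by
    have : Continuous fun l => 2 * F l * Real.exp (2 * mass w x) := by fun_prop
    simpa [hFdef] using this.tendsto l₀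
  refine squeeze_zero' (Eventually.of_forall fun _ => norm_nonneg _) ?_ hFlim
  filter_upwards [hev] with l hl
  have hlpos : 0 < l.im := by linarith
  have hadm := admissible_zero hlpos.le
  have hadm₀ := admissible_zero hl₀.le
  obtain ⟨hc, ⟨L, hL⟩, hv⟩ := isModifiedJostMinus_iff.1
    (isModifiedJostMinus_modifiedJostMinus hw hi hadm)
  set m := modifiedJostMinus w l 0
  have hbd : ∀ x, ‖m x - m₀ x‖ ≤ L + K := fun x =>
    (norm_sub_le _ _).trans (add_le_add (hL x) (hK x))
  have hint : Integrable fun y => ‖w y‖ * ‖m y - m₀ y‖ := by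
    refine (hi.norm.mul_const (L + K)).mono' (by fun_prop) (Eventually.of_forall fun y => ?_)
    rw [Real.norm_of_nonneg (by positivity)]
    have := hbd y
    gcongr
  refine gronwall_Iic hw hi (d := fun x => ‖m x - m₀ x‖) (by fun_prop)
    (fun _ => norm_nonneg _) hbd (hF0 l) (fun x => ?_) x
  refine (pi_norm_le_iff_of_nonneg (add_nonneg (hF0 l)
    (integral_nonneg fun y => by positivity))).2 fun i => ?_
  have hexp : ∀ r : ℝ, 0 ≤ r → ‖exp (rate l 0 i * (r : ℂ)) - exp (rate l₀ 0 i * (r : ℂ))‖ ≤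
      l₀.im⁻¹ * (2 * ‖l - l₀‖) := by
    intro r hr
    fin_cases i
    · simp only [Fin.zero_eta, rate_self, sub_self, norm_zero]
      positivity
    · simp only [Fin.mk_one, rate_zero_one]
      refine (norm_exp_mul_sub_exp_mul_le hl₀ ?_ ?_ hr).trans (le_of_eq ?_)
      · simp
        linarith
      · simp
        linarith
      · rw [← mul_sub, norm_mul]
        simp
  have h1 : ‖duhamel (rate l 0 i) (fun y => (potentialMatrix (w y) *ᵥ m₀ y) i) x -
      duhamel (rate l₀ 0 i) (fun y => (potentialMatrix (w y) *ᵥ m₀ y) i) x‖ ≤ F l := by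
    refine (norm_duhamel_sub_le (hadm i) (hadm₀ i) hexp (by positivity) (hG i) (hGi i) x).trans ?_
    refine mul_le_mul_of_nonneg_left ?_ (by positivity)
    rw [← integral_mul_const]
    refine integral_mono (hGi i).norm (hi.norm.mul_const K) fun y => ?_
    refine (norm_potentialMatrix_mulVec_le _ _ _).trans ?_
    have := hK y
    gcongr
  have h2 : ‖duhamel (rate l 0 i) (fun y => (potentialMatrix (w y) *ᵥ m y) i) x -
      duhamel (rate l 0 i) (fun y => (potentialMatrix (w y) *ᵥ m₀ y) i) x‖ ≤
      ∫ y in Set.Iic x, ‖w y‖ * ‖m y - m₀ y‖ := by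
    have hmi := integrable_potentialMatrix_mulVec hw hi hc hL i
    rw [duhamel_sub (hadm i) (continuous_potentialMatrix_mulVec hw hc i) hmi (hG i) (hGi i)]
    refine (norm_duhamel_le (hadm i) (hmi.sub (hGi i)) x).trans ?_
    refine integral_mono ((hmi.sub (hGi i)).norm.integrableOn) hint.integrableOn fun y => ?_
    change ‖(potentialMatrix (w y) *ᵥ m y) i - (potentialMatrix (w y) *ᵥ m₀ y) i‖ ≤ _
    rw [← Pi.sub_apply, ← Matrix.mulVec_sub]
    exact norm_potentialMatrix_mulVec_le _ _ _
  rw [Pi.sub_apply, hv, hv₀, add_sub_add_left_eq_sub]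
  refine (norm_sub_le_norm_sub_add_norm_sub _
    (duhamel (rate l 0 i) (fun y => (potentialMatrix (w y) *ᵥ m₀ y) i) x) _).trans ?_
  linarith

theorem modifiedJostPlus_eq_reflectSol {w : ℝ → ℂ} (hw : Continuous w) (hi : Integrable w)
    {l : ℂ} {j : Fin 2} (hlj : Admissible l j.rev) :
    modifiedJostPlus w l j = reflectSol (modifiedJostMinus (reflect w) l j.rev) := by
  have h := isModifiedJostPlus_iff_reflect.1 (isModifiedJostPlus_modifiedJostPlus hw hi hlj)
  have := h.unique (continuous_reflect hw) (integrable_reflect hi) hlj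
    (isModifiedJostMinus_modifiedJostMinus (continuous_reflect hw) (integrable_reflect hi) hlj)
  rw [← this, reflectSol_reflectSol]

theorem continuousAt_modifiedJostPlus {w : ℝ → ℂ} (hw : Continuous w) (hi : Integrable w)
    {l₀ : ℂ} (hl₀ : 0 < l₀.im) (x : ℝ) (i : Fin 2) :
    ContinuousAt (fun l => modifiedJostPlus w l 1 x i) l₀ := by
  have h := continuousAt_modifiedJostMinus (continuous_reflect hw) (integrable_reflect hi) hl₀ (-x)
  have h' : ContinuousAt (fun l => modifiedJostMinus (reflect w) l 0 (-x) i.rev) l₀ :=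
    (continuous_apply i.rev).continuousAt.comp h
  refine h'.congr ?_
  filter_upwards [continuous_im.continuousAt.eventually_const_lt hl₀] with l hl
  rw [modifiedJostPlus_eq_reflectSol hw hi (j := 1) (admissible_zero hl.le)]
  rfl

theorem det_columns_jost (u : ℝ → ℝ → ℂ) (t x : ℝ) (l : ℂ) :
    (columns (jostMinus u t x l 0) (jostPlus u t x l 1)).det =
      modifiedJostMinus (u t) l 0 x 0 * modifiedJostPlus (u t) l 1 x 1 -
        modifiedJostPlus (u t) l 1 x 0 * modifiedJostMinus (u t) l 0 x 1 := by
  have h : exp (-(I * theta t x l * sgn 0)) * exp (-(I * theta t x l * sgn 1)) = 1 := by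
    rw [← exp_add]
    simp [sgn]
  rw [columns, Matrix.det_fin_two_of]
  simp only [jostMinus, jostPlus, Pi.smul_apply, smul_eq_mul]
  linear_combination (modifiedJostMinus (u t) l 0 x 0 * modifiedJostPlus (u t) l 1 x 1 -
    modifiedJostPlus (u t) l 1 x 0 * modifiedJostMinus (u t) l 0 x 1) * h

theorem continuousAt_det_columns_jost {u : ℝ → ℝ → ℂ} {t : ℝ} (hw : Continuous (u t))
    (hi : Integrable (u t)) {l₀ : ℂ} (hl₀ : 0 < l₀.im) (x : ℝ) :
    ContinuousAt (fun l => (columns (jostMinus u t x l 0) (jostPlus u t x l 1)).det) l₀ := by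
  simp only [det_columns_jost]
  have h : ∀ i, ContinuousAt (fun l => modifiedJostMinus (u t) l 0 x i) l₀ := fun i =>
    (continuous_apply i).continuousAt.comp (continuousAt_modifiedJostMinus hw hi hl₀ x)
  exact ((h 0).mul (continuousAt_modifiedJostPlus hw hi hl₀ x 1)).sub
    ((continuousAt_modifiedJostPlus hw hi hl₀ x 0).mul (h 1))

theorem admissible_rev_one {l : ℂ} (hl : 0 ≤ l.im) : Admissible l (Fin.rev 1) :=
  admissible_zero hl

/-! ### The Darboux pair of the seed solution -/

theorem exp_two_theta_norm (t x : ℝ) (l : ℂ) :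
    ‖exp (2 * (I * theta t x l))‖ = Real.exp (-(2 * (l.im * x + (2 * l ^ 2 * t).im))) := by
  rw [norm_exp]
  congr 1
  simp only [theta, mul_re, I_re, I_im, add_im, add_re, mul_im, ofReal_re, ofReal_im, re_ofNat,
    im_ofNat]
  ring

theorem tendsto_exp_two_theta (t : ℝ) {l : ℂ} (hl : 0 < l.im) :
    Tendsto (fun x : ℝ => exp (2 * (I * theta t x l))) atTop (𝓝 0) := by
  rw [tendsto_zero_iff_norm_tendsto_zero]
  simp only [exp_two_theta_norm]
  refine Real.tendsto_exp_atBot.comp (tendsto_neg_atTop_atBot.comp ?_)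
  exact (tendsto_atTop_add_const_right _ _ (tendsto_id.const_mul_atTop hl)).const_mul_atTop
    (by norm_num)

theorem tendsto_exp_neg_two_theta (t : ℝ) {l : ℂ} (hl : 0 < l.im) :
    Tendsto (fun x : ℝ => exp (-(2 * (I * theta t x l)))) atBot (𝓝 0) := by
  rw [tendsto_zero_iff_norm_tendsto_zero]
  simp only [exp_neg, norm_inv, exp_two_theta_norm, Real.exp_neg, inv_inv]
  refine Real.tendsto_exp_atBot.comp ?_
  exact (tendsto_atBot_add_const_right _ _ (tendsto_id.const_mul_atBot hl)).const_mul_atBot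
    (by norm_num)

section Seed

variable {u : ℝ → ℝ → ℂ} {t : ℝ} {l₀ u₀ v₀ α : ℂ}

theorem seedSolution_eq_smul_atBot (u : ℝ → ℝ → ℂ) (l₀ u₀ v₀ : ℂ) (t x : ℝ) :
    seedSolution u l₀ u₀ v₀ t x = exp (I * theta t x l₀) • fun i =>
      u₀ * exp (-(2 * (I * theta t x l₀))) * modifiedJostMinus (u t) l₀ 0 x i +
        v₀ * modifiedJostPlus (u t) l₀ 1 x i := by
  have h : exp (I * theta t x l₀) * exp (-(2 * (I * theta t x l₀))) =
      exp (-(I * theta t x l₀)) := by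
    rw [← exp_add]
    congr 1
    ring
  funext i
  simp only [seedSolution, jostMinus, jostPlus, sgn, Pi.add_apply, Pi.smul_apply, smul_eq_mul,
    Matrix.cons_val_zero, Matrix.cons_val_one, mul_one, mul_neg, neg_neg]
  linear_combination -(u₀ * modifiedJostMinus (u t) l₀ 0 x i) * h

theorem seedSolution_eq_smul_atTop (u : ℝ → ℝ → ℂ) (l₀ u₀ v₀ : ℂ) (t x : ℝ) :
    seedSolution u l₀ u₀ v₀ t x = exp (-(I * theta t x l₀)) • fun i =>
      u₀ * modifiedJostMinus (u t) l₀ 0 x i +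
        v₀ * exp (2 * (I * theta t x l₀)) * modifiedJostPlus (u t) l₀ 1 x i := by
  have h : exp (-(I * theta t x l₀)) * exp (2 * (I * theta t x l₀)) =
      exp (I * theta t x l₀) := by
    rw [← exp_add]
    congr 1
    ring
  funext i
  simp only [seedSolution, jostMinus, jostPlus, sgn, Pi.add_apply, Pi.smul_apply, smul_eq_mul,
    Matrix.cons_val_zero, Matrix.cons_val_one, mul_one, mul_neg, neg_neg]
  linear_combination -(v₀ * modifiedJostPlus (u t) l₀ 1 x i) * h

/-- The Wronskian `a₁₁(l₀)` is the limit of the second component of `m_+^{(2)}` at `-∞`. -/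
theorem tendsto_modifiedJostPlus_one_atBot (hw : Continuous (u t)) (hi : Integrable (u t))
    (hl₀ : 0 < l₀.im)
    (hα : ∀ x, α = (columns (jostMinus u t x l₀ 0) (jostPlus u t x l₀ 1)).det) :
    Tendsto (fun x => modifiedJostPlus (u t) l₀ 1 x 1) atBot (𝓝 α) := by
  have hmin := isModifiedJostMinus_modifiedJostMinus hw hi (admissible_zero hl₀.le)
  have hplus := isModifiedJostPlus_modifiedJostPlus (j := 1) hw hi (admissible_rev_one hl₀.le)
  have h0 := hmin.tendsto_atBot hw hi (admissible_zero hl₀.le) 0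
  have h1 := hmin.tendsto_atBot hw hi (admissible_zero hl₀.le) 1
  have h2 := hplus.tendsto_atBot_zero hw hi hl₀
  simp only [if_true, one_ne_zero, if_false] at h0 h1
  have h3 : Tendsto (fun x => (α + modifiedJostPlus (u t) l₀ 1 x 0 *
      modifiedJostMinus (u t) l₀ 0 x 1) / modifiedJostMinus (u t) l₀ 0 x 0) atBot
      (𝓝 ((α + 0 * 0) / 1)) := ((h2.mul h1).const_add α).div h0 one_ne_zero
  simp only [mul_zero, add_zero, div_one] at h3
  refine h3.congr' ?_
  filter_upwards [h0.eventually_ne one_ne_zero] with x hx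
  have := hα x
  rw [det_columns_jost] at this
  rw [div_eq_iff hx, this]
  ring

/-- The Wronskian `a₁₁(l₀)` is the limit of the first component of `m_-^{(1)}` at `+∞`. -/
theorem tendsto_modifiedJostMinus_zero_atTop (hw : Continuous (u t)) (hi : Integrable (u t))
    (hl₀ : 0 < l₀.im)
    (hα : ∀ x, α = (columns (jostMinus u t x l₀ 0) (jostPlus u t x l₀ 1)).det) :
    Tendsto (fun x => modifiedJostMinus (u t) l₀ 0 x 0) atTop (𝓝 α) := by
  have hmin := isModifiedJostMinus_modifiedJostMinus hw hi (admissible_zero hl₀.le)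
  have hplus := isModifiedJostPlus_modifiedJostPlus (j := 1) hw hi (admissible_rev_one hl₀.le)
  have h0 := hplus.tendsto_atTop hw hi (admissible_rev_one hl₀.le) 0
  have h1 := hplus.tendsto_atTop hw hi (admissible_rev_one hl₀.le) 1
  have h2 := hmin.tendsto_atTop_one hw hi hl₀
  simp only [if_true, zero_ne_one, if_false] at h0 h1
  have h3 : Tendsto (fun x => (α + modifiedJostPlus (u t) l₀ 1 x 0 *
      modifiedJostMinus (u t) l₀ 0 x 1) / modifiedJostPlus (u t) l₀ 1 x 1) atTop
      (𝓝 ((α + 0 * 0) / 1)) := ((h0.mul h2).const_add α).div h1 one_ne_zero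
  simp only [mul_zero, add_zero, div_one] at h3
  refine h3.congr' ?_
  filter_upwards [h1.eventually_ne one_ne_zero] with x hx
  have := hα x
  rw [det_columns_jost] at this
  rw [div_eq_iff hx, this]
  ring

/-- As `a₁₁(l₀) ≠ 0`, the seed solution is dominated by `ψ_+^{(2)}` at `-∞` and by `ψ_-^{(1)}` at
`+∞`. -/
theorem isDarbouxPair_seedSolution (hw : Continuous (u t)) (hi : Integrable (u t))
    (hl₀ : 0 < l₀.im) (hu₀ : u₀ ≠ 0) (hv₀ : v₀ ≠ 0) (hα0 : α ≠ 0)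
    (hα : ∀ x, α = (columns (jostMinus u t x l₀ 0) (jostPlus u t x l₀ 1)).det) :
    IsDarbouxPair (u t) l₀ (fun x => projOff (seedSolution u l₀ u₀ v₀ t x))
      (fun x => projDiff (seedSolution u l₀ u₀ v₀ t x)) := by
  have hmin := isModifiedJostMinus_modifiedJostMinus hw hi (admissible_zero hl₀.le)
  have hplus := isModifiedJostPlus_modifiedJostPlus (j := 1) hw hi (admissible_rev_one hl₀.le)
  have hsol : IsSolution (u t) l₀ (fun x => seedSolution u l₀ u₀ v₀ t x) :=
    IsSolution.smul_add_smul ((hmin.isModifiedSolution hw hi (admissible_zero hl₀.le)).isSolution t)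
      ((hplus.isModifiedSolution hw hi (admissible_rev_one hl₀.le)).isSolution t) u₀ v₀
  refine hsol.isDarbouxPair (fun x hx => hα0 ?_) ?_ ?_
  · -- a vanishing seed makes the two Jost columns linearly dependent
    have h0 := congrFun hx 0
    have h1 := congrFun hx 1
    simp only [seedSolution, Pi.add_apply, Pi.smul_apply, smul_eq_mul, Pi.zero_apply] at h0 h1
    have hdet : u₀ * α = 0 := by
      rw [hα x, columns, Matrix.det_fin_two_of]
      linear_combination jostPlus u t x l₀ 1 1 * h0 - jostPlus u t x l₀ 1 0 * h1
    exact (mul_eq_zero.1 hdet).resolve_left hu₀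
  · simp only [seedSolution_eq_smul_atBot, projDiff_smul (exp_ne_zero _)]
    have hz : (![0, v₀ * α] : Fin 2 → ℂ) ≠ 0 := fun h => by
      have := congrFun h 1
      simp [hv₀, hα0] at this
    have hE := tendsto_exp_neg_two_theta t hl₀
    have h0 := ((hE.const_mul u₀).mul (hmin.tendsto_atBot hw hi (admissible_zero hl₀.le) 0)).add
      ((hplus.tendsto_atBot_zero hw hi hl₀).const_mul v₀)
    have h1 := ((hE.const_mul u₀).mul (hmin.tendsto_atBot hw hi (admissible_zero hl₀.le) 1)).add
      ((tendsto_modifiedJostPlus_one_atBot hw hi hl₀ hα).const_mul v₀)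
    have h := tendsto_projDiff hz (F := atBot) (v := fun x i =>
      u₀ * exp (-(2 * (I * theta t x l₀))) * modifiedJostMinus (u t) l₀ 0 x i +
        v₀ * modifiedJostPlus (u t) l₀ 1 x i)
      (Fin.forall_fin_two.2 ⟨by simpa using h0, by simpa using h1⟩)
    have hval : projDiff ![0, v₀ * α] = 1 := by
      simp [projDiff, hv₀, hα0]
    rwa [hval] at h
  · simp only [seedSolution_eq_smul_atTop, projDiff_smul (exp_ne_zero _)]
    have hz : (![u₀ * α, 0] : Fin 2 → ℂ) ≠ 0 := fun h => by
      have := congrFun h 0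
      simp [hu₀, hα0] at this
    have hE := tendsto_exp_two_theta t hl₀
    have h0 := ((tendsto_modifiedJostMinus_zero_atTop hw hi hl₀ hα).const_mul u₀).add
      ((hE.const_mul v₀).mul (hplus.tendsto_atTop hw hi (admissible_rev_one hl₀.le) 0))
    have h1 := ((hmin.tendsto_atTop_one hw hi hl₀).const_mul u₀).add
      ((hE.const_mul v₀).mul (hplus.tendsto_atTop hw hi (admissible_rev_one hl₀.le) 1))
    have h := tendsto_projDiff hz (F := atTop) (v := fun x i =>
      u₀ * modifiedJostMinus (u t) l₀ 0 x i +
        v₀ * exp (2 * (I * theta t x l₀)) * modifiedJostPlus (u t) l₀ 1 x i)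
      (Fin.forall_fin_two.2 ⟨by simpa using h0, by simpa using h1⟩)
    have hval : projDiff ![u₀ * α, 0] = -1 := by
      have h2 : normSq (u₀ * α) ≠ 0 := (normSq_pos.2 (mul_ne_zero hu₀ hα0)).ne'
      simp only [projDiff, Matrix.cons_val_zero, Matrix.cons_val_one, map_zero, zero_sub, add_zero]
      rw [neg_div, div_self h2]
    rwa [hval] at h

end Seed

/-- The Darboux matrix at `l = l₀` annihilates the vector it is built from. -/
theorem darbouxFactor_mulVec_self (l₀ : ℂ) {v : Fin 2 → ℂ} (hv : v ≠ 0) :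
    darbouxFactor l₀ l₀ (projOff v) (projDiff v) *ᵥ v = 0 := by
  have hN : v 0 * conj (v 0) + v 1 * conj (v 1) ≠ 0 := by
    rw [mul_conj, mul_conj, ← ofReal_add]
    exact ofReal_ne_zero.2 (normSq_add_pos hv).ne'
  have hN' : conj (v 0) * v 0 + conj (v 1) * v 1 ≠ 0 := by
    rwa [mul_comm (conj (v 0)), mul_comm (conj (v 1))]
  have hq : ((projDiff v : ℝ) : ℂ) = (v 1 * conj (v 1) - v 0 * conj (v 0)) /
      (v 0 * conj (v 0) + v 1 * conj (v 1)) := by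
    simp only [projDiff, ofReal_div, ofReal_sub, ofReal_add, mul_conj]
  have hp : projOff v = v 0 * conj (v 1) / (v 0 * conj (v 0) + v 1 * conj (v 1)) := by
    simp only [projOff, ofReal_add, mul_conj]
  have hl : l₀ - l₀.re = I * l₀.im := by
    apply Complex.ext <;> simp
  funext i
  fin_cases i
  · simp only [Fin.zero_eta, darbouxFactor_mulVec_zero, hl, hq, hp, Pi.zero_apply]
    field_simp
    ring
  · simp only [Fin.mk_one, darbouxFactor_mulVec_one, hl, hq, hp, Pi.zero_apply, map_div₀, map_mul,
      map_add, conj_conj]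
    rw [mul_comm (conj (v 0)) (v 0), mul_comm (conj (v 1)) (v 1)]
    field_simp
    ring

/-! ### The Jost columns of the transformed potential -/

theorem IsModifiedSolution.const_smul {w : ℝ → ℂ} {l : ℂ} {j : Fin 2} {m : ℝ → Fin 2 → ℂ}
    (hm : IsModifiedSolution w l j m) (c : ℂ) :
    IsModifiedSolution w l j (fun x => c • m x) := by
  intro x i
  have := (hm x i).const_mul c
  simp only [Pi.smul_apply, smul_eq_mul, Matrix.mulVec_smul]
  refine this.congr_deriv ?_
  ring

namespace IsDarbouxPair

variable {w : ℝ → ℂ} {l₀ : ℂ} {p : ℝ → ℂ} {q : ℝ → ℝ}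

theorem modifiedJostMinus_eq (h : IsDarbouxPair w l₀ p q) (hw : Continuous w)
    (hi : Integrable w) (hi' : Integrable fun x => w x + 4 * l₀.im * p x) {l : ℂ} {j : Fin 2}
    (hlj : Admissible l j) {κ : ℂ} (hκ : κ = l - l₀.re + sgn j * I * l₀.im) (hκ0 : κ ≠ 0) (x : ℝ) :
    modifiedJostMinus (fun x => w x + 4 * l₀.im * p x) l j x =
      κ⁻¹ • (darbouxFactor l₀ l (p x) (q x) *ᵥ modifiedJostMinus w l j x) := by
  have hp := h.continuous_p
  have hw' : Continuous fun x => w x + 4 * l₀.im * p x := by fun_prop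
  have hJ := isModifiedJostMinus_modifiedJostMinus hw hi hlj
  obtain ⟨K, hK⟩ := hJ.bounded
  obtain ⟨K', hK'⟩ := h.exists_norm_mulVec_le l hK
  have hlim := h.tendsto_mulVec l (one_pow 2) h.tendsto_atBot (hJ.tendsto_atBot hw hi hlj)
  have hnew := ((h.isModifiedSolution (hJ.isModifiedSolution hw hi hlj)).const_smul
    κ⁻¹).isModifiedJostMinus hw' hi' hlj (K := ‖κ⁻¹‖ * K')
    (fun x => by
      rw [norm_smul]
      have := hK' x
      gcongr)
    (fun i => by
      convert! (hlim i).const_mul κ⁻¹ using 2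
      split_ifs
      · rw [ofReal_one, mul_one, ← hκ, inv_mul_cancel₀ hκ0]
      · exact (mul_zero _).symm)
  exact congrFun ((isModifiedJostMinus_modifiedJostMinus hw' hi' hlj).unique hw' hi' hlj hnew) x

theorem modifiedJostPlus_eq (h : IsDarbouxPair w l₀ p q) (hw : Continuous w)
    (hi : Integrable w) (hi' : Integrable fun x => w x + 4 * l₀.im * p x) {l : ℂ} {j : Fin 2}
    (hlj : Admissible l j.rev) {κ : ℂ} (hκ : κ = l - l₀.re - sgn j * I * l₀.im) (hκ0 : κ ≠ 0)
    (x : ℝ) :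
    modifiedJostPlus (fun x => w x + 4 * l₀.im * p x) l j x =
      κ⁻¹ • (darbouxFactor l₀ l (p x) (q x) *ᵥ modifiedJostPlus w l j x) := by
  have hp := h.continuous_p
  have hw' : Continuous fun x => w x + 4 * l₀.im * p x := by fun_prop
  have hJ := isModifiedJostPlus_modifiedJostPlus hw hi hlj
  obtain ⟨K, hK⟩ := hJ.bounded
  obtain ⟨K', hK'⟩ := h.exists_norm_mulVec_le l hK
  have hlim := h.tendsto_mulVec l (s := -1) (by norm_num) h.tendsto_atTop
    (hJ.tendsto_atTop hw hi hlj)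
  have hnew := ((h.isModifiedSolution (hJ.isModifiedSolution hw hi hlj)).const_smul
    κ⁻¹).isModifiedJostPlus hw' hi' hlj (K := ‖κ⁻¹‖ * K')
    (fun x => by
      rw [norm_smul]
      have := hK' x
      gcongr)
    (fun i => by
      convert! (hlim i).const_mul κ⁻¹ using 2
      split_ifs
      · rw [show l - l₀.re + sgn j * ((-1 : ℝ) : ℂ) * I * l₀.im = κ by
          rw [hκ]
          push_cast
          ring, inv_mul_cancel₀ hκ0]
      · exact (mul_zero _).symm)
  exact congrFun ((isModifiedJostPlus_modifiedJostPlus hw' hi' hlj).unique hw' hi' hlj hnew) x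

end IsDarbouxPair

theorem columns_mulVec (D : Matrix (Fin 2) (Fin 2) ℂ) (a b : Fin 2 → ℂ) :
    columns (D *ᵥ a) (D *ᵥ b) = D * columns a b := by
  ext i j
  fin_cases i <;> fin_cases j <;>
    simp [columns, Matrix.mulVec, dotProduct, Fin.sum_univ_two, Matrix.mul_apply]

theorem columns_smul (c d : ℂ) (a b : Fin 2 → ℂ) :
    columns (c • a) (d • b) = columns a b * Matrix.diagonal ![c, d] := by
  ext i j
  fin_cases i <;> fin_cases j <;>
    simp [columns, Matrix.mul_diagonal, mul_comm]

theorem hasDerivAt_sub_mul_of_continuousAt {h : ℂ → ℂ} {z : ℂ} (hh : ContinuousAt h z) :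
    HasDerivAt (fun l => (l - z) * h l) (h z) z := by
  rw [hasDerivAt_iff_tendsto_slope]
  refine (hh.tendsto.mono_left nhdsWithin_le_nhds).congr' ?_
  filter_upwards [self_mem_nhdsWithin] with l hl
  have : l - z ≠ 0 := sub_ne_zero.2 hl
  simp [slope_def_field, this]

/-! ### The transformed scattering data -/

section Transformed

variable {u u' : ℝ → ℝ → ℂ} {t : ℝ} {l₀ : ℂ} {p : ℝ → ℂ} {q : ℝ → ℝ}

/-- Here `κ` is the limit at `-∞` of the `j`-th diagonal entry of `D`: `l - l₀*` for `j = 0` and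
`l - l₀` for `j = 1`. -/
theorem IsDarbouxPair.jostMinus_eq (h : IsDarbouxPair (u t) l₀ p q) (hw : Continuous (u t))
    (hi : Integrable (u t)) (hu' : u' t = fun x => u t x + 4 * l₀.im * p x)
    (hi' : Integrable (u' t)) {l : ℂ} {j : Fin 2} (hlj : Admissible l j) {κ : ℂ}
    (hκ : κ = l - l₀.re + sgn j * I * l₀.im) (hκ0 : κ ≠ 0) (x : ℝ) :
    jostMinus u' t x l j = κ⁻¹ • (darbouxFactor l₀ l (p x) (q x) *ᵥ jostMinus u t x l j) := by
  rw [hu'] at hi'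
  rw [jostMinus, hu', h.modifiedJostMinus_eq hw hi hi' hlj hκ hκ0, jostMinus, Matrix.mulVec_smul,
    smul_comm]

/-- Here `κ` is the limit at `+∞` of the `j`-th diagonal entry of `D`: `l - l₀` for `j = 0` and
`l - l₀*` for `j = 1`. -/
theorem IsDarbouxPair.jostPlus_eq (h : IsDarbouxPair (u t) l₀ p q) (hw : Continuous (u t))
    (hi : Integrable (u t)) (hu' : u' t = fun x => u t x + 4 * l₀.im * p x)
    (hi' : Integrable (u' t)) {l : ℂ} {j : Fin 2} (hlj : Admissible l j.rev) {κ : ℂ}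
    (hκ : κ = l - l₀.re - sgn j * I * l₀.im) (hκ0 : κ ≠ 0) (x : ℝ) :
    jostPlus u' t x l j = κ⁻¹ • (darbouxFactor l₀ l (p x) (q x) *ᵥ jostPlus u t x l j) := by
  rw [hu'] at hi'
  rw [jostPlus, hu', h.modifiedJostPlus_eq hw hi hi' hlj hκ hκ0, jostPlus, Matrix.mulVec_smul,
    smul_comm]

theorem sub_ne_zero_of_im {l l₀ : ℂ} (hl₀ : 0 < l₀.im) (hl : l.im = 0) : l - l₀ ≠ 0 := fun h => by
  have := congrArg im h
  simp at this
  linarith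

theorem sub_conj_ne_zero {l l₀ : ℂ} (hl₀ : 0 < l₀.im) (hl : 0 ≤ l.im) : l - conj l₀ ≠ 0 :=
  fun h => by
  have := congrArg im h
  simp at this
  linarith

theorem IsDarbouxPair.jostMinus_zero (h : IsDarbouxPair (u t) l₀ p q) (hl₀ : 0 < l₀.im)
    (hw : Continuous (u t)) (hi : Integrable (u t))
    (hu' : u' t = fun x => u t x + 4 * l₀.im * p x) (hi' : Integrable (u' t)) {l : ℂ}
    (hl : 0 ≤ l.im) (x : ℝ) :
    jostMinus u' t x l 0 = (l - conj l₀)⁻¹ •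
      (darbouxFactor l₀ l (p x) (q x) *ᵥ jostMinus u t x l 0) :=
  h.jostMinus_eq hw hi hu' hi' (admissible_zero hl)
    (by rw [sub_conj_eq_re_im]; simp [sgn]) (sub_conj_ne_zero hl₀ hl) x

theorem IsDarbouxPair.jostPlus_one (h : IsDarbouxPair (u t) l₀ p q) (hl₀ : 0 < l₀.im)
    (hw : Continuous (u t)) (hi : Integrable (u t))
    (hu' : u' t = fun x => u t x + 4 * l₀.im * p x) (hi' : Integrable (u' t)) {l : ℂ}
    (hl : 0 ≤ l.im) (x : ℝ) :
    jostPlus u' t x l 1 = (l - conj l₀)⁻¹ •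
      (darbouxFactor l₀ l (p x) (q x) *ᵥ jostPlus u t x l 1) :=
  h.jostPlus_eq hw hi hu' hi' (admissible_rev_one hl)
    (by rw [sub_conj_eq_re_im]; simp [sgn]) (sub_conj_ne_zero hl₀ hl) x

/-- The new `a₁₁`: the factor is `det D` divided by the two normalisations `l - l₀*`. -/
theorem IsDarbouxPair.det_columns_jost (h : IsDarbouxPair (u t) l₀ p q) (hl₀ : 0 < l₀.im)
    (hw : Continuous (u t)) (hi : Integrable (u t))
    (hu' : u' t = fun x => u t x + 4 * l₀.im * p x) (hi' : Integrable (u' t)) {l : ℂ}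
    (hl : 0 ≤ l.im) (x : ℝ) :
    (columns (jostMinus u' t x l 0) (jostPlus u' t x l 1)).det = (l - l₀) / (l - conj l₀) *
      (columns (jostMinus u t x l 0) (jostPlus u t x l 1)).det := by
  have hne := sub_conj_ne_zero hl₀ hl
  rw [h.jostMinus_zero hl₀ hw hi hu' hi' hl, h.jostPlus_one hl₀ hw hi hu' hi' hl, columns_smul,
    columns_mulVec, Matrix.det_mul, Matrix.det_mul, det_darbouxFactor _ _ _ (h.sq_add x),
    Matrix.det_diagonal, Fin.prod_univ_two]
  simp only [Matrix.cons_val_zero, Matrix.cons_val_one]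
  field_simp

/-- `D` cancels in `(D Ψ_+ N_+)⁻¹ (D Ψ_- N_-)`, so only the diagonal normalisations `N_±` of the new
Jost solutions change the scattering matrix. -/
theorem IsDarbouxPair.scatteringMatrix_eq (h : IsDarbouxPair (u t) l₀ p q) (hl₀ : 0 < l₀.im)
    (hw : Continuous (u t)) (hi : Integrable (u t))
    (hu' : u' t = fun x => u t x + 4 * l₀.im * p x) (hi' : Integrable (u' t)) (x ξ : ℝ) :
    scatteringMatrix u' t x ξ = Matrix.diagonal ![ξ - l₀, ξ - conj l₀] *
      scatteringMatrix u t x ξ * Matrix.diagonal ![(ξ - conj l₀)⁻¹, (ξ - l₀)⁻¹] := by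
  have h1 : (ξ : ℂ) - l₀ ≠ 0 := sub_ne_zero_of_im hl₀ (ofReal_im ξ)
  have h2 : (ξ : ℂ) - conj l₀ ≠ 0 := sub_conj_ne_zero hl₀ (ofReal_im ξ).ge
  have hm1 := h.jostMinus_eq hw hi hu' hi' (admissible_ofReal ξ 1) (κ := ξ - l₀)
    (by rw [sub_eq_re_im]; simp [sgn]; ring) h1 x
  have hp0 := h.jostPlus_eq (j := 0) hw hi hu' hi' (admissible_ofReal ξ _) (κ := ξ - l₀)
    (by rw [sub_eq_re_im]; simp [sgn]) h1 x
  set D := darbouxFactor l₀ ξ (p x) (q x) with hD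
  have hdet : IsUnit D.det := by
    rw [hD, det_darbouxFactor _ _ _ (h.sq_add x)]
    exact (mul_ne_zero h1 h2).isUnit
  have hdiag : (Matrix.diagonal ![((ξ : ℂ) - l₀)⁻¹, ((ξ : ℂ) - conj l₀)⁻¹])⁻¹ =
      Matrix.diagonal ![(ξ : ℂ) - l₀, ξ - conj l₀] := by
    refine Matrix.inv_eq_left_inv ?_
    rw [Matrix.diagonal_mul_diagonal, ← Matrix.diagonal_one]
    congr 1
    funext i
    fin_cases i
    · exact mul_inv_cancel₀ h1
    · exact mul_inv_cancel₀ h2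
  rw [scatteringMatrix, h.jostMinus_zero hl₀ hw hi hu' hi' (ofReal_im ξ).ge,
    h.jostPlus_one hl₀ hw hi hu' hi' (ofReal_im ξ).ge, hm1, hp0, columns_smul, columns_smul,
    columns_mulVec, columns_mulVec, Matrix.mul_inv_rev, Matrix.mul_inv_rev, hdiag,
    scatteringMatrix, ← hD]
  simp only [Matrix.mul_assoc]
  rw [← Matrix.mul_assoc D⁻¹ D, Matrix.nonsing_inv_mul D hdet, Matrix.one_mul]

end Transformed

end NLSScattering

open NLSScattering in
theorem mainTheorem2 (u : ℝ → ℝ → ℂ) (t : ℝ) (a₁₁ : ℂ → ℂ) (a₁₂ ρ : ℝ → ℂ) (N : ℕ)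
    (lam b C : Fin N → ℂ)
    (hdata : NLSScattering.IsScatteringData u t a₁₁ a₁₂ ρ lam b C)
    (l₀ : ℂ) (hl₀ : 0 < l₀.im) (hl₀_new : ∀ j, l₀ ≠ lam j)
    (u₀ v₀ : ℂ) (hu₀ : u₀ ≠ 0) (hv₀ : v₀ ≠ 0) :
    NLSScattering.IsScatteringData (NLSScattering.darbouxPotential u l₀ u₀ v₀) t
      (fun l : ℂ => (l - l₀) / (l - conj l₀) * a₁₁ l)
      a₁₂
      (fun ξ : ℝ => ((ξ : ℂ) - conj l₀) / ((ξ : ℂ) - l₀) * ρ ξ)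
      (Fin.cons l₀ lam : Fin (N + 1) → ℂ)
      (Fin.cons (-(v₀ / u₀)) b : Fin (N + 1) → ℂ)
      (Fin.cons (-(v₀ / u₀) * ((l₀ - conj l₀) / a₁₁ l₀))
        (fun j => (lam j - conj l₀) / (lam j - l₀) * C j) : Fin (N + 1) → ℂ) := by
  have hw := hdata.memH11.continuous
  have hi := hdata.memH11.integrable
  have hα0 : a₁₁ l₀ ≠ 0 := fun h => by
    obtain ⟨j, hj⟩ := (hdata.zeros l₀ hl₀.le).1 h
    exact hl₀_new j hj
  have hpair := isDarbouxPair_seedSolution hw hi hl₀ hu₀ hv₀ hα0 (hdata.a₁₁_upper l₀ hl₀)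
  have hu' : darbouxPotential u l₀ u₀ v₀ t = fun x =>
      u t x + 4 * l₀.im * projOff (seedSolution u l₀ u₀ v₀ t x) :=
    funext fun x => darbouxPotential_eq u l₀ u₀ v₀ t x
  have hH11 : MemH11 (darbouxPotential u l₀ u₀ v₀ t) := by
    rw [hu']
    exact hpair.memH11 hl₀ hdata.memH11
  have hi' := hH11.integrable
  have hne : ∀ l : ℂ, 0 ≤ l.im → l - conj l₀ ≠ 0 := fun l hl => sub_conj_ne_zero hl₀ hl
  have hlam_ne : ∀ j, lam j - l₀ ≠ 0 := fun j => sub_ne_zero.2 (hl₀_new j).symm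
  have hlam_ne' : ∀ j, lam j - conj l₀ ≠ 0 := fun j => hne _ (hdata.lam_upper j).le
  -- differentiability of `a₁₁` at an eigenvalue is part of the eigenvalue being simple
  have hderiv_lam : ∀ j, HasDerivAt (fun l : ℂ => (l - l₀) / (l - conj l₀) * a₁₁ l)
      ((lam j - l₀) / (lam j - conj l₀) * deriv a₁₁ (lam j)) (lam j) := by
    intro j
    have hd := (differentiableAt_of_deriv_ne_zero (hdata.simple j)).hasDerivAt
    have hg := ((hasDerivAt_id (lam j)).sub_const l₀).div
      ((hasDerivAt_id (lam j)).sub_const (conj l₀)) (hlam_ne' j)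
    refine (hg.mul hd).congr_deriv ?_
    rw [(hdata.zeros _ (hdata.lam_upper j).le).2 ⟨j, rfl⟩, mul_zero, zero_add]
    rfl
  -- at `l₀` the factor `l - l₀` vanishes, so continuity of `a₁₁` suffices
  have hderiv_new : HasDerivAt (fun l : ℂ => (l - l₀) / (l - conj l₀) * a₁₁ l)
      (a₁₁ l₀ / (l₀ - conj l₀)) l₀ := by
    have hcont : ContinuousAt a₁₁ l₀ := by
      refine (continuousAt_det_columns_jost hw hi hl₀ 0).congr ?_
      filter_upwards [continuous_im.continuousAt.eventually_const_lt hl₀] with l hl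
      exact (hdata.a₁₁_upper l hl 0).symm
    have hden : ContinuousAt (fun l : ℂ => l - conj l₀) l₀ := by fun_prop
    refine (hasDerivAt_sub_mul_of_continuousAt (hcont.div hden (hne l₀ hl₀.le))).congr_of_eventuallyEq
      (Filter.Eventually.of_forall fun l => ?_)
    simp only [Pi.div_apply]
    ring
  refine
    { memH11 := hH11
      a₁₁_real := fun ξ x => ?_
      a₁₁_upper := fun l hl x => ?_
      a₁₂_real := fun ξ x => ?_
      ρ_eq := fun ξ => ?_
      lam_upper := Fin.cases hl₀ hdata.lam_upper
      lam_injective := ?_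
      zeros := fun l hl => ?_
      simple := Fin.cases ?_ fun j => ?_
      b_eq := Fin.cases (fun x => ?_) fun j x => ?_
      C_eq := Fin.cases ?_ fun j => ?_ }
  · rw [hpair.scatteringMatrix_eq hl₀ hw hi hu' hi', Matrix.mul_diagonal, Matrix.diagonal_mul,
      ← hdata.a₁₁_real ξ x]
    simp only [Matrix.cons_val_zero]
    ring
  · rw [hpair.det_columns_jost hl₀ hw hi hu' hi' hl.le, hdata.a₁₁_upper l hl x]
  · have h1 : (ξ : ℂ) - l₀ ≠ 0 := sub_ne_zero_of_im hl₀ (ofReal_im ξ)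
    rw [hpair.scatteringMatrix_eq hl₀ hw hi hu' hi', Matrix.mul_diagonal, Matrix.diagonal_mul,
      ← hdata.a₁₂_real ξ x]
    simp only [Matrix.cons_val_zero, Matrix.cons_val_one]
    field_simp
  · rw [hdata.ρ_eq]
    simp only [div_eq_mul_inv, mul_inv, inv_inv]
    ring
  · exact Fin.cons_injective_iff.2 ⟨fun ⟨j, hj⟩ => hl₀_new j hj.symm, hdata.lam_injective⟩
  · rw [mul_eq_zero, div_eq_zero_iff, or_iff_left (hne l hl), sub_eq_zero, hdata.zeros l hl,
      Fin.exists_fin_succ]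
    simp only [Fin.cons_zero, Fin.cons_succ]
  · rw [Fin.cons_zero, hderiv_new.deriv]
    exact div_ne_zero hα0 (hne l₀ hl₀.le)
  · rw [Fin.cons_succ, (hderiv_lam j).deriv]
    exact mul_ne_zero (div_ne_zero (hlam_ne j) (hlam_ne' j)) (hdata.simple j)
  · -- `D` annihilates the seed solution at `l = l₀`
    have hseed : seedSolution u l₀ u₀ v₀ t x ≠ 0 := fun h => by
      have := hpair.sq_add x
      simp [h, projOff, projDiff] at this
    have h0 := darbouxFactor_mulVec_self l₀ hseed
    rw [Fin.cons_zero, Fin.cons_zero, hpair.jostMinus_zero hl₀ hw hi hu' hi' hl₀.le,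
      hpair.jostPlus_one hl₀ hw hi hu' hi' hl₀.le, smul_comm]
    congr 1
    generalize darbouxFactor l₀ l₀ (projOff (seedSolution u l₀ u₀ v₀ t x))
      (projDiff (seedSolution u l₀ u₀ v₀ t x)) = D at h0 ⊢
    rw [seedSolution, Matrix.mulVec_add, Matrix.mulVec_smul, Matrix.mulVec_smul] at h0
    funext i
    have := congrFun h0 i
    simp only [Pi.add_apply, Pi.smul_apply, smul_eq_mul, Pi.zero_apply] at this ⊢
    field_simp
    linear_combination this
  · rw [Fin.cons_succ, Fin.cons_succ, hpair.jostMinus_zero hl₀ hw hi hu' hi'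
      (hdata.lam_upper j).le, hpair.jostPlus_one hl₀ hw hi hu' hi' (hdata.lam_upper j).le,
      hdata.b_eq j x, Matrix.mulVec_smul, smul_comm]
  · rw [Fin.cons_zero, Fin.cons_zero, Fin.cons_zero, hderiv_new.deriv, inv_div]
  · rw [Fin.cons_succ, Fin.cons_succ, Fin.cons_succ, (hderiv_lam j).deriv, hdata.C_eq j, mul_inv,
      inv_div]
    ring
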